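/- **Setting.** A *regular ordered Banach space* is a real Banach space $V$ with a partial order compatible with the linear structure and with norm-closed positive cone $V^+$, such that $-y\le x\le y$ implies $\|x\|\le\|y\|$, and $\|x\|=\inf\{\|y\| : -y\le x\le y\}$ for all $x$. For a measurable space $X$, $\mathcal M X$ is the space of signed measures of bounded variation on $X$, with the total variation norm and the order $\mu\le\nu$ iff $\mu(A)\le\nu(A)$ for all measurable $A$. For regular ordered Banach spaces $U,V$, the positive projective tensor product $U\,\widehat\otimes_{|\pi|}V$ is the completion of the algebraic tensor product $U\otimes V$ for $$\|x\|_{|\pi|}=\inf\Big\{\sum_{i=1}^n\|u_i\|\|v_i\| : u_i\in U^+,\ v_i\in V^+,\ -\sum_i u_i\otimes v_i\le x\le\sum_i u_i\otimes v_i\Big\},$$ where $U\otimes V$ is ordered by the cone of finite sums of tensors $u\otimes v$ with $u\in U^+$, $v\in V^+$, and the positive cone of the completion is the norm closure of (the image of) this cone. If $V$ is a Riesz space (its order is a lattice) and $v\in V$, then $V_v$ is the principal band generated by $v$, i.e. the smallest band of $V$ containing $v$, with the norm and order of $V$. *Measure types* $T$ and their denotations $[\![T]\!]$ are defined simultaneously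 by induction: - ground types, for integers $m,n\ge1$: $[\![m]\!]=\mathcal M\{1,\dots,m\}$ and $[\![\mathtt{int}^n]\!]=\mathcal M(\mathbb N^n)$ (discrete $\sigma$-algebras), $[\![\mathtt{real}^n]\!]=\mathcal M(\mathbb R^n)$ and $[\![\mathtt{PosDef}(n)]\!]=\mathcal M(\{\text{positive semidefinite real symmetric } n\times n \text{ matrices}\})$ (Borel $\sigma$-algebras); - Bayesian types: if $T$ is a measure type and $\mu\in[\![T]\!]$, then $(T,\mu)$ is a measure type with $[\![(T,\mu)]\!]=[\![T]\!]_\mu$; - tensor types: $[\![S\otimes T]\!]=[\![S]\!]\,\widehat\otimes_{|\pi|}[\![T]\!]$; - higher-order probability types: $[\![\mathtt M\,T]\!]=\mathcal M[\![T]\!]$, where $[\![T]\!]$ carries the Borel $\sigma$-algebra of its norm. **Theorem.** Let $T$ be a measure type. Then $[\![T]\!]$ is a Riesz space (so that the denotations of Bayesian types are well defined), and $[\![T]\!]$ embeds isometrically and monotonically into a space of measures: there are a measurable space $X$ and a linear isometry $J:[\![T]\!]\to\mathcal M X$ such that $x\le y$ if and only if $Jx\le Jy$, for all $x,y\in[\![T]\!]$.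 -/

import Mathlib

open MeasureTheory Filter Topology
open scoped ENNReal TensorProduct

namespace MeasSem

/-- Regular ordered Banach spaces: complete normed spaces with a compatible partial order and
a norm-closed positive cone, satisfying the two regularity axioms. -/
class RegularOrderedBanach (V : Type) [NormedAddCommGroup V] [NormedSpace ℝ V]
    [PartialOrder V] : Prop where
  add_le_add_right' : ∀ u v w : V, u ≤ v → u + w ≤ v + w
  smul_le_smul' : ∀ (c : ℝ) (u v : V), 0 ≤ c → u ≤ v → c • u ≤ c • v
  complete : CompleteSpace V
  isClosed_cone : IsClosed {v : V | 0 ≤ v}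
  norm_le_of_abs_le : ∀ x y : V, -y ≤ x → x ≤ y → ‖x‖ ≤ ‖y‖
  isGLB_norm : ∀ x : V, IsGLB {r : ℝ | ∃ y : V, -y ≤ x ∧ x ≤ y ∧ r = ‖y‖} ‖x‖

/-- The objects of the category `RoBan`. -/
structure RoBan where
  carrier : Type
  [normed : NormedAddCommGroup carrier]
  [space : NormedSpace ℝ carrier]
  [order : PartialOrder carrier]
  [regular : RegularOrderedBanach carrier]

namespace RoBan

instance : CoeSort RoBan Type := ⟨RoBan.carrier⟩

attribute [instance] RoBan.normed RoBan.space RoBan.order RoBan.regular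

end RoBan

section Basic

variable {V : Type} [NormedAddCommGroup V] [NormedSpace ℝ V] [PartialOrder V]
  [RegularOrderedBanach V]

instance (priority := 50) : CompleteSpace V := RegularOrderedBanach.complete

instance (priority := 50) : IsOrderedAddMonoid V where
  add_le_add_left u v h w := RegularOrderedBanach.add_le_add_right' u v w h

theorem smul_nonneg_of_nonneg {c : ℝ} {v : V} (hc : 0 ≤ c) (hv : 0 ≤ v) : 0 ≤ c • v := by
  simpa using RegularOrderedBanach.smul_le_smul' c 0 v hc hv

theorem exists_abs_le (x : V) {ε : ℝ} (hε : 0 < ε) :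
    ∃ y : V, -y ≤ x ∧ x ≤ y ∧ ‖y‖ < ‖x‖ + ε := by
  obtain ⟨r, ⟨y, h1, h2, rfl⟩, h3⟩ :=
    (isGLB_lt_iff (RegularOrderedBanach.isGLB_norm x)).1 (lt_add_of_pos_right ‖x‖ hε)
  exact ⟨y, h1, h2, h3⟩

theorem nonneg_of_abs_le {x y : V} (h1 : -y ≤ x) (h2 : x ≤ y) : 0 ≤ y := by
  have h : 0 ≤ y + y := by simpa using add_le_add_right (h1.trans h2) y
  have := smul_nonneg_of_nonneg (c := (1/2 : ℝ)) (by norm_num) h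
  rwa [← two_smul ℝ y, smul_smul, show (1/2 : ℝ) * 2 = 1 by norm_num, one_smul] at this

end Basic

/-! ### Spaces of signed measures -/

section Measures

variable {X : Type} [MeasurableSpace X]

instance (μ : SignedMeasure X) : IsFiniteMeasure μ.variation := by
  rw [← SignedMeasure.totalVariation_eq_variation]
  unfold SignedMeasure.totalVariation
  infer_instance

/-- The space of signed measures (of bounded variation) is normed by the total variation
`|μ|(X)`, where `|μ|` is the supremum of `∑ |μ(Aᵢ)|` over measurable partitions. -/
noncomputable instance instNormedSignedMeasure : NormedAddCommGroup (SignedMeasure X) :=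
  AddGroupNorm.toNormedAddCommGroup
    { toFun := fun μ => μ.variation.real Set.univ
      map_zero' := by simp
      add_le' := fun μ ν => by
        have h := VectorMeasure.variation_add_le (μ := μ) (ν := ν) Set.univ
        rw [← measureReal_add_apply]
        exact ENNReal.toReal_mono (measure_ne_top _ _) h
      neg' := fun μ => by simp
      eq_zero_of_map_eq_zero' := fun μ h => by
        rw [measureReal_eq_zero_iff] at h
        simpa using h }

theorem norm_signedMeasure (μ : SignedMeasure X) : ‖μ‖ = μ.variation.real Set.univ := rfl

noncomputable instance instNormedSpaceSignedMeasure : NormedSpace ℝ (SignedMeasure X) where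
  norm_smul_le c μ := by
    rw [norm_signedMeasure, norm_signedMeasure, VectorMeasure.variation_smul,
      measureReal_nnreal_smul_apply]
    simp

theorem abs_apply_le_variation (μ : SignedMeasure X) (A : Set X) :
    |μ A| ≤ μ.variation.real A :=
  VectorMeasure.norm_measure_le_variation (μ := μ) (E := A)

theorem abs_apply_le_norm (μ : SignedMeasure X) (A : Set X) : |μ A| ≤ ‖μ‖ :=
  (abs_apply_le_variation μ A).trans
    (measureReal_mono (Set.subset_univ A))

theorem norm_signedMeasure_le {μ : SignedMeasure X} {m : Measure X} [IsFiniteMeasure m]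
    (h : ∀ E, MeasurableSet E → |μ E| ≤ m.real E) : ‖μ‖ ≤ m.real Set.univ := by
  refine ENNReal.toReal_mono (measure_ne_top _ _)
    (VectorMeasure.variation_le_of_forall_enorm_le (fun E hE => ?_) Set.univ)
  rw [← ENNReal.ofReal_toReal (measure_ne_top m E), ← ofReal_norm]
  exact ENNReal.ofReal_le_ofReal (h E hE)

theorem variation_toSignedMeasure (m : Measure X) [IsFiniteMeasure m] :
    ‖m.toSignedMeasure‖ = m.real Set.univ := by
  rw [norm_signedMeasure, Measure.variation_toSignedMeasure]

theorem signedMeasure_sum_apply (u : ℕ → SignedMeasure X) (n : ℕ) (E : Set X) :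
    (∑ i ∈ Finset.range n, u i) E = ∑ i ∈ Finset.range n, u i E := by
  induction n with
  | zero => simp
  | succ n ih => rw [Finset.sum_range_succ, Finset.sum_range_succ, add_apply, ih]

theorem hasSum_measureReal (m : ℕ → Measure X) [IsFiniteMeasure (Measure.sum m)] {E : Set X}
    (hE : MeasurableSet E) : HasSum (fun i => (m i).real E) ((Measure.sum m).real E) := by
  have h1 : Measure.sum m E = ∑' i, m i E := Measure.sum_apply _ hE
  have h2 : ∑' i, m i E ≠ ∞ := h1 ▸ measure_ne_top _ _
  rw [measureReal_def, h1, ENNReal.tsum_toReal_eq (ENNReal.ne_top_of_tsum_ne_top h2)]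
  exact ENNReal.hasSum_toReal h2

theorem isFiniteMeasure_sum_variation {u : ℕ → SignedMeasure X} (hu : Summable fun i => ‖u i‖) :
    IsFiniteMeasure (Measure.sum fun i => (u i).variation) := by
  refine ⟨?_⟩
  have h : ∀ i, (u i).variation Set.univ = ENNReal.ofReal ‖u i‖ := fun i => by
    rw [norm_signedMeasure, ofReal_measureReal]
  rw [Measure.sum_apply _ MeasurableSet.univ]
  simp only [h]
  rw [← ENNReal.ofReal_tsum_of_nonneg (fun _ => norm_nonneg _) hu]
  exact ENNReal.ofReal_lt_top

theorem norm_le_tsum {u : ℕ → SignedMeasure X} (hu : Summable fun i => ‖u i‖)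
    {a : SignedMeasure X} (ha : ∀ E, MeasurableSet E → HasSum (fun i => u i E) (a E)) :
    ‖a‖ ≤ ∑' i, ‖u i‖ := by
  have hfin := isFiniteMeasure_sum_variation hu
  have h2 := hasSum_measureReal (fun i => (u i).variation) MeasurableSet.univ
  refine (norm_signedMeasure_le (m := Measure.sum fun i => (u i).variation)
    fun E hE => ?_).trans_eq h2.tsum_eq.symm
  have h1 := hasSum_measureReal (fun i => (u i).variation) hE
  have hle : ∀ i, |u i E| ≤ (u i).variation.real E := fun i => abs_apply_le_variation (u i) E
  have h3 : Summable fun i => |u i E| :=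
    Summable.of_nonneg_of_le (fun _ => abs_nonneg _) hle h1.summable
  rw [← (ha E hE).tsum_eq, ← h1.tsum_eq]
  exact (norm_tsum_le_tsum_norm (f := fun i => u i E) h3).trans (h3.tsum_le_tsum hle h1.summable)

theorem exists_setwise_sum {u : ℕ → SignedMeasure X} (hu : Summable fun i => ‖u i‖) :
    ∃ a : SignedMeasure X, ∀ E, MeasurableSet E → HasSum (fun i => u i E) (a E) := by
  have hfin := isFiniteMeasure_sum_variation hu
  have hvar : ∀ i, (u i).variation = (u i).toJordanDecomposition.posPart
      + (u i).toJordanDecomposition.negPart := fun i => by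
    rw [← SignedMeasure.totalVariation_eq_variation, SignedMeasure.totalVariation]
  have hP : IsFiniteMeasure (Measure.sum fun i => (u i).toJordanDecomposition.posPart) := by
    refine isFiniteMeasure_of_le (Measure.sum fun i => (u i).variation)
      (Measure.le_iff.2 fun s hs => ?_)
    rw [Measure.sum_apply _ hs, Measure.sum_apply _ hs]
    refine ENNReal.tsum_le_tsum fun i => ?_
    rw [hvar, Measure.add_apply]
    exact le_self_add
  have hN : IsFiniteMeasure (Measure.sum fun i => (u i).toJordanDecomposition.negPart) := by
    refine isFiniteMeasure_of_le (Measure.sum fun i => (u i).variation)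
      (Measure.le_iff.2 fun s hs => ?_)
    rw [Measure.sum_apply _ hs, Measure.sum_apply _ hs]
    refine ENNReal.tsum_le_tsum fun i => ?_
    rw [hvar, Measure.add_apply]
    exact le_add_self
  refine ⟨Measure.toSignedMeasure (Measure.sum fun i => (u i).toJordanDecomposition.posPart)
    - Measure.toSignedMeasure (Measure.sum fun i => (u i).toJordanDecomposition.negPart),
    fun E hE => ?_⟩
  have h := (hasSum_measureReal (fun i => (u i).toJordanDecomposition.posPart) hE).sub
    (hasSum_measureReal (fun i => (u i).toJordanDecomposition.negPart) hE)
  rw [Measure.toSignedMeasure_sub_apply hE]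
  simpa only [(u _).apply_eq_posPart_real_sub_negPart_real hE] using h

instance : CompleteSpace (SignedMeasure X) := by
  refine NormedAddCommGroup.completeSpace_of_summable_imp_tendsto fun u hu => ?_
  obtain ⟨a, ha⟩ := exists_setwise_sum hu
  refine ⟨a, ?_⟩
  rw [tendsto_iff_norm_sub_tendsto_zero]
  refine squeeze_zero (fun _ => norm_nonneg _) (fun n => ?_) (tendsto_sum_nat_add fun i => ‖u i‖)
  rw [norm_sub_rev]
  refine norm_le_tsum ((summable_nat_add_iff n).2 hu) fun E hE => ?_
  have h := (hasSum_nat_add_iff' n).2 (ha E hE)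
  rwa [← signedMeasure_sum_apply, ← sub_apply a] at h

instance instRegularSignedMeasure : RegularOrderedBanach (SignedMeasure X) where
  add_le_add_right' u v w h := fun A hA => by
    simpa using h A hA
  smul_le_smul' c u v hc h := fun A hA => by
    simpa using mul_le_mul_of_nonneg_left (h A hA) hc
  complete := inferInstance
  isClosed_cone := by
    refine IsSeqClosed.isClosed fun f μ hf hμ => ?_
    intro A hA
    have h : Tendsto (fun n => f n A) atTop (𝓝 (μ A)) := by
      rw [tendsto_iff_norm_sub_tendsto_zero] at hμ ⊢
      refine squeeze_zero (fun _ => norm_nonneg _) (fun n => ?_) hμ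
      have := abs_apply_le_norm (f n - μ) A
      simpa using this
    exact ge_of_tendsto' h fun n => hf n A hA
  norm_le_of_abs_le μ ν h1 h2 := by
    have h0 : ∀ A, MeasurableSet A → |μ A| ≤ ν A := fun A hA =>
      abs_le.2 ⟨by simpa using h1 A hA, h2 A hA⟩
    have h3 : ∀ A, MeasurableSet A → |μ A| ≤ ν.variation.real A := fun A hA =>
      (h0 A hA).trans ((le_abs_self _).trans (abs_apply_le_variation ν A))
    exact norm_signedMeasure_le h3
  isGLB_norm μ := by
    refine ⟨?_, fun r hr => hr ⟨μ.variation.toSignedMeasure, ?_, ?_, ?_⟩⟩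
    · rintro _ ⟨ν, h1, h2, rfl⟩
      have h0 : ∀ A, MeasurableSet A → |μ A| ≤ ν A := fun A hA =>
        abs_le.2 ⟨by simpa using h1 A hA, h2 A hA⟩
      exact norm_signedMeasure_le fun A hA =>
        (h0 A hA).trans ((le_abs_self _).trans (abs_apply_le_variation ν A))
    · intro A hA
      have h : |μ A| ≤ μ.variation.real A := abs_apply_le_variation μ A
      simpa [hA] using (abs_le.1 h).1
    · intro A hA
      have h : |μ A| ≤ μ.variation.real A := abs_apply_le_variation μ A
      simpa [hA] using (abs_le.1 h).2
    · rw [variation_toSignedMeasure]; rfl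

end Measures

/-- The space `𝓜 X` of signed measures on a measurable space, with the total variation norm
and the setwise order. -/
noncomputable def RoBan.measures (X : Type) [MeasurableSpace X] : RoBan := ⟨SignedMeasure X⟩

/-! ### Riesz spaces and principal bands -/

/-- A partially ordered space is a Riesz space if its order is a lattice. -/
def IsRiesz (V : Type) [PartialOrder V] : Prop :=
  ∀ x y : V, (∃ s, IsLUB {x, y} s) ∧ ∃ i, IsGLB {x, y} i

/-- The lattice structure that the order of a Riesz space determines. -/
@[reducible]
noncomputable def IsRiesz.lattice {V : Type} [PartialOrder V] (h : IsRiesz V) : Lattice V where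
  __ := (inferInstance : PartialOrder V)
  sup x y := (h x y).1.choose
  inf x y := (h x y).2.choose
  le_sup_left x y := (h x y).1.choose_spec.1 (by simp)
  le_sup_right x y := (h x y).1.choose_spec.1 (by simp)
  sup_le x y z hx hy := (h x y).1.choose_spec.2 (by rintro _ (rfl | rfl) <;> assumption)
  inf_le_left x y := (h x y).2.choose_spec.1 (by simp)
  inf_le_right x y := (h x y).2.choose_spec.1 (by simp)
  le_inf x y z hx hy := (h y z).2.choose_spec.2 (by rintro _ (rfl | rfl) <;> assumption)

section Band

variable {V : Type} [NormedAddCommGroup V] [NormedSpace ℝ V] [PartialOrder V]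

/-- A linear subspace `U` is a band if it is solid (`|u| ≤ |v|` and `v ∈ U` imply `u ∈ U`)
and contains every supremum, taken in `V`, of a subset of `U`.
The modulus `|v|` is the least upper bound of `v` and `-v`. -/
structure IsBand (U : Submodule ℝ V) : Prop where
  solid : ∀ u v a b : V, IsLUB {u, -u} a → IsLUB {v, -v} b → a ≤ b → v ∈ U → u ∈ U
  sup_mem : ∀ (D : Set V) (s : V), D ⊆ U → IsLUB D s → s ∈ U

/-- The principal band generated by `v`: the smallest band containing `v`. -/
def principalBand (v : V) : Submodule ℝ V :=
  sInf {U | IsBand U ∧ v ∈ U}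

theorem mem_principalBand (v : V) : v ∈ principalBand v := by
  simp [principalBand, Submodule.mem_sInf]

theorem isBand_principalBand (v : V) : IsBand (principalBand v) where
  solid u w a b ha hb hab hw := by
    simp only [principalBand, Submodule.mem_sInf] at hw ⊢
    exact fun U hU => hU.1.solid u w a b ha hb hab (hw U hU)
  sup_mem D s hD hs := by
    simp only [principalBand, Submodule.mem_sInf]
    refine fun U hU => hU.1.sup_mem D s (fun d hd => ?_) hs
    have := hD hd
    simp only [principalBand, SetLike.mem_coe, Submodule.mem_sInf] at this
    exact this U hU

variable [RegularOrderedBanach V]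

theorem isClosed_Iic' (z : V) : IsClosed {x : V | x ≤ z} := by
  have : {x : V | x ≤ z} = (fun x => z - x) ⁻¹' {v | 0 ≤ v} := by ext; simp
  rw [this]
  exact RegularOrderedBanach.isClosed_cone.preimage (by fun_prop)

theorem norm_modulus {x a : V} (ha : IsLUB {x, -x} a) : ‖a‖ = ‖x‖ := by
  have h1 : x ≤ a := ha.1 (by simp)
  have h2 : -x ≤ a := ha.1 (by simp)
  have h3 : 0 ≤ a := nonneg_of_abs_le (neg_le.1 h2) h1
  refine le_antisymm ?_ (RegularOrderedBanach.norm_le_of_abs_le x a (neg_le.1 h2) h1)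
  refine (RegularOrderedBanach.isGLB_norm x).2 ?_
  rintro _ ⟨y, hy1, hy2, rfl⟩
  have h4 : a ≤ y := ha.2 (by rintro _ (rfl | rfl); exacts [hy2, neg_le.1 hy1])
  exact RegularOrderedBanach.norm_le_of_abs_le a y
    ((neg_nonpos.2 (h3.trans h4)).trans h3) h4

/-- Bands of a Banach lattice are norm closed. -/
theorem IsBand.isClosed (hV : IsRiesz V) {U : Submodule ℝ V} (hU : IsBand U) :
    IsClosed (U : Set V) := by
  let _ : Lattice V := hV.lattice
  have habs : ∀ x : V, IsLUB {x, -x} |x| := fun x => isLUB_pair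
  have : HasSolidNorm V := ⟨fun x y h => by
    rw [← norm_modulus (habs x), ← norm_modulus (habs y)]
    exact RegularOrderedBanach.norm_le_of_abs_le _ _
      ((neg_nonpos.2 (abs_nonneg _)).trans (abs_nonneg _)) h⟩
  refine IsSeqClosed.isClosed fun f w hf hw => ?_
  have hmem : ∀ n, |f n| ⊓ |w| ∈ U := fun n =>
    hU.solid _ (f n) _ _ (habs _) (habs _)
      (by rw [abs_of_nonneg (le_inf (abs_nonneg _) (abs_nonneg _))]; exact inf_le_left) (hf n)
  have hlim : Tendsto (fun n => |f n| ⊓ |w|) atTop (𝓝 |w|) := by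
    rw [tendsto_iff_norm_sub_tendsto_zero] at hw ⊢
    refine squeeze_zero (fun _ => norm_nonneg _) (fun n => ?_) hw
    calc ‖|f n| ⊓ |w| - |w|‖ = ‖|f n| ⊓ |w| - |w| ⊓ |w|‖ := by rw [inf_idem]
      _ ≤ ‖|f n| - |w|‖ := norm_inf_sub_inf_le_norm _ _ _
      _ ≤ ‖f n - w‖ := norm_abs_sub_abs _ _
  have hlub : IsLUB (Set.range fun n => |f n| ⊓ |w|) |w| := by
    refine ⟨?_, fun z hz => ?_⟩
    · rintro _ ⟨n, rfl⟩
      exact inf_le_right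
    · exact (isClosed_Iic' z).mem_of_tendsto hlim
        (Eventually.of_forall fun n => hz ⟨n, rfl⟩)
  have : |w| ∈ U := hU.sup_mem _ _ (by rintro _ ⟨n, rfl⟩; exact hmem n) hlub
  exact hU.solid w |w| _ _ (habs _) (habs _) (by rw [abs_abs]) this

/-- A band of a Banach lattice, with the inherited norm and order, is a regular ordered
Banach space. -/
theorem IsBand.regular (hV : IsRiesz V) {U : Submodule ℝ V} (hU : IsBand U) :
    RegularOrderedBanach U where
  add_le_add_right' u v w h := by
    have : (u : V) ≤ v := h
    have : (u : V) + w ≤ v + w := RegularOrderedBanach.add_le_add_right' _ _ _ this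
    exact this
  smul_le_smul' c u v hc h := by
    have : c • (u : V) ≤ c • (v : V) := RegularOrderedBanach.smul_le_smul' _ _ _ hc h
    exact this
  complete := (hU.isClosed hV).completeSpace_coe
  isClosed_cone := (RegularOrderedBanach.isClosed_cone (V := V)).preimage continuous_subtype_val
  norm_le_of_abs_le x y h1 h2 := RegularOrderedBanach.norm_le_of_abs_le (x : V) y h1 h2
  isGLB_norm x := by
    refine ⟨?_, fun r hr => ?_⟩
    · rintro _ ⟨y, h1, h2, rfl⟩
      exact RegularOrderedBanach.norm_le_of_abs_le (x : V) y h1 h2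
    · let _ : Lattice V := hV.lattice
      have habs : ∀ x : V, IsLUB {x, -x} |x| := fun x => isLUB_pair
      have hmem : |(x : V)| ∈ U :=
        hU.solid _ (x : V) _ _ (habs _) (habs _) (by rw [abs_abs]) x.2
      refine hr ⟨⟨|(x : V)|, hmem⟩, ?_, ?_, ?_⟩
      · exact neg_le.1 (neg_le_abs (x : V))
      · exact le_abs_self (x : V)
      · exact (norm_modulus (habs x)).symm

end Band

open Classical in
/-- The principal band generated by `v` in a Riesz space `V`, as an ordered Banach space.
Bands are only meaningful in Riesz spaces, which all denotations of measure types are; on any other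
space the value is a dummy one. -/
noncomputable def RoBan.band (V : RoBan) (v : V) : RoBan :=
  if h : IsRiesz V then
    { carrier := principalBand v
      regular := (isBand_principalBand v).regular h }
  else V

/-! ### The positive projective tensor product -/

section Tensor

variable (U V : RoBan)

/-- The algebraic tensor product of the underlying vector spaces. -/
def AlgTensor : Type := U ⊗[ℝ] V

noncomputable instance : AddCommGroup (AlgTensor U V) := inferInstanceAs (AddCommGroup (U ⊗[ℝ] V))
noncomputable instance : Module ℝ (AlgTensor U V) := inferInstanceAs (Module ℝ (U ⊗[ℝ] V))

variable {U V}

/-- Elementary tensors. -/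
noncomputable def AlgTensor.tmul (u : U) (v : V) : AlgTensor U V := u ⊗ₜ[ℝ] v

variable (U V)

/-- The positive cone of the algebraic tensor product: finite sums of tensors `u ⊗ v` with
`u` and `v` positive. -/
noncomputable def AlgTensor.cone : AddSubmonoid (AlgTensor U V) :=
  AddSubmonoid.closure {t | ∃ (u : U) (v : V), 0 ≤ u ∧ 0 ≤ v ∧ t = AlgTensor.tmul u v}

variable {U V}

/-- The numbers `∑ ‖uᵢ‖ ‖vᵢ‖`, where the `uᵢ` and `vᵢ` are positive and
`-∑ uᵢ ⊗ vᵢ ≤ x ≤ ∑ uᵢ ⊗ vᵢ`. -/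
def AlgTensor.costs (x : AlgTensor U V) : Set ℝ :=
  {r | ∃ (n : ℕ) (u : Fin n → U) (v : Fin n → V), (∀ i, 0 ≤ u i) ∧ (∀ i, 0 ≤ v i) ∧
    x - (-∑ i, AlgTensor.tmul (u i) (v i)) ∈ AlgTensor.cone U V ∧
    (∑ i, AlgTensor.tmul (u i) (v i)) - x ∈ AlgTensor.cone U V ∧
    r = ∑ i, ‖u i‖ * ‖v i‖}

/-- The positive projective norm. -/
noncomputable def AlgTensor.posProjNorm (x : AlgTensor U V) : ℝ := sInf (AlgTensor.costs x)

namespace AlgTensor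

theorem tmul_add (u : U) (v w : V) : tmul u (v + w) = tmul u v + tmul u w :=
  TensorProduct.tmul_add u v w

theorem add_tmul (u w : U) (v : V) : tmul (u + w) v = tmul u v + tmul w v :=
  TensorProduct.add_tmul u w v

theorem smul_tmul' (c : ℝ) (u : U) (v : V) : c • tmul u v = tmul (c • u) v :=
  TensorProduct.smul_tmul' c u v

theorem tmul_neg (u : U) (v : V) : tmul u (-v) = -tmul u v :=
  TensorProduct.tmul_neg u v

theorem tmul_mem_cone {u : U} {v : V} (hu : 0 ≤ u) (hv : 0 ≤ v) : tmul u v ∈ cone U V :=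
  AddSubmonoid.subset_closure ⟨u, v, hu, hv, rfl⟩

theorem smul_mem_cone {c : ℝ} (hc : 0 ≤ c) {x : AlgTensor U V} (hx : x ∈ cone U V) :
    c • x ∈ cone U V := by
  induction hx using AddSubmonoid.closure_induction with
  | mem x hx =>
    obtain ⟨u, v, hu, hv, rfl⟩ := hx
    rw [smul_tmul']
    exact tmul_mem_cone (smul_nonneg_of_nonneg hc hu) hv
  | zero => rw [smul_zero]; exact zero_mem _
  | add x y _ _ hx hy => rw [smul_add]; exact add_mem hx hy

theorem half_smul_add_self (x : AlgTensor U V) : (1 / 2 : ℝ) • (x + x) = x := by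
  rw [← two_smul ℝ x, smul_smul]; norm_num

/-- Elementary tensors are dominated by tensors of dominating elements. -/
theorem tmul_dominated {a u : U} {b v : V} (h1 : -a ≤ u) (h2 : u ≤ a) (h3 : -b ≤ v) (h4 : v ≤ b) :
    tmul u v - (-tmul a b) ∈ cone U V ∧ tmul a b - tmul u v ∈ cone U V := by
  have e1 : 0 ≤ a + u := by simpa using sub_nonneg.2 h1 |>.trans_eq (by abel)
  have e2 : 0 ≤ a - u := sub_nonneg.2 h2
  have e3 : 0 ≤ b + v := by simpa using sub_nonneg.2 h3 |>.trans_eq (by abel)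
  have e4 : 0 ≤ b - v := sub_nonneg.2 h4
  have key : ∀ (p q : U) (r s : V), tmul (p + q) (r + s) + tmul (p - q) (r - s)
      = (tmul p r + tmul q s) + (tmul p r + tmul q s) := fun p q r s => by
    simp only [sub_eq_add_neg, tmul_add, add_tmul, tmul_neg]
    have : ∀ w : V, tmul (-q) w = - tmul q w := fun w => TensorProduct.neg_tmul q w
    simp only [this]
    abel
  constructor
  · have h := smul_mem_cone (c := 1 / 2) (by norm_num)
      (add_mem (tmul_mem_cone e1 e3) (tmul_mem_cone e2 e4))
    rw [key, half_smul_add_self] at h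
    simpa [add_comm] using h
  · have h := smul_mem_cone (c := 1 / 2) (by norm_num)
      (add_mem (tmul_mem_cone e1 e4) (tmul_mem_cone e2 e3))
    have k := key a u b (-v)
    rw [sub_neg_eq_add, ← sub_eq_add_neg] at k
    rw [k, half_smul_add_self, tmul_neg] at h
    simpa [sub_eq_add_neg] using h

theorem costs_nonneg {x : AlgTensor U V} {r : ℝ} (hr : r ∈ costs x) : 0 ≤ r := by
  obtain ⟨n, u, v, _, _, _, _, rfl⟩ := hr
  positivity

theorem bddBelow_costs (x : AlgTensor U V) : BddBelow (costs x) :=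
  ⟨0, fun _ hr => costs_nonneg hr⟩

theorem costs_add {x y : AlgTensor U V} {r s : ℝ} (hr : r ∈ costs x) (hs : s ∈ costs y) :
    r + s ∈ costs (x + y) := by
  obtain ⟨n, u, v, hu, hv, h1, h2, rfl⟩ := hr
  obtain ⟨m, u', v', hu', hv', h1', h2', rfl⟩ := hs
  refine ⟨n + m, Fin.append u u', Fin.append v v', ?_, ?_, ?_, ?_, ?_⟩
  · intro i; refine Fin.addCases (fun i => ?_) (fun i => ?_) i <;> simp [hu, hu']
  · intro i; refine Fin.addCases (fun i => ?_) (fun i => ?_) i <;> simp [hv, hv']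
  · convert add_mem h1 h1' using 1
    simp only [Fin.sum_univ_add, Fin.append_left, Fin.append_right]
    abel
  · convert add_mem h2 h2' using 1
    simp only [Fin.sum_univ_add, Fin.append_left, Fin.append_right]
    abel
  · simp [Fin.sum_univ_add]

theorem costs_neg {x : AlgTensor U V} {r : ℝ} (hr : r ∈ costs x) : r ∈ costs (-x) := by
  obtain ⟨n, u, v, hu, hv, h1, h2, rfl⟩ := hr
  refine ⟨n, u, v, hu, hv, ?_, ?_, rfl⟩
  · convert h2 using 1; abel
  · convert h1 using 1; abel

theorem costs_smul_nonneg {x : AlgTensor U V} {r c : ℝ} (hc : 0 ≤ c) (hr : r ∈ costs x) :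
    c * r ∈ costs (c • x) := by
  obtain ⟨n, u, v, hu, hv, h1, h2, rfl⟩ := hr
  refine ⟨n, fun i => c • u i, v, fun i => smul_nonneg_of_nonneg hc (hu i), hv, ?_, ?_, ?_⟩
  · convert smul_mem_cone hc h1 using 1
    simp only [← smul_tmul', ← Finset.smul_sum, smul_sub, smul_neg]
  · convert smul_mem_cone hc h2 using 1
    simp only [← smul_tmul', ← Finset.smul_sum, smul_sub]
  · simp only [norm_smul, Real.norm_of_nonneg hc, Finset.mul_sum, mul_assoc]

theorem zero_mem_costs : (0 : ℝ) ∈ costs (0 : AlgTensor U V) :=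
  ⟨0, Fin.elim0, Fin.elim0, fun i => i.elim0, fun i => i.elim0, by simp, by simp, by simp⟩

theorem costs_nonempty (x : AlgTensor U V) : (costs x).Nonempty := by
  refine TensorProduct.induction_on (motive := fun x : U ⊗[ℝ] V => (costs (U := U) (V := V) x).Nonempty)
    x ⟨0, zero_mem_costs⟩ (fun u v => ?_) (fun x y hx hy => ?_)
  · obtain ⟨a, h1, h2, -⟩ := exists_abs_le u one_pos
    obtain ⟨b, h3, h4, -⟩ := exists_abs_le v one_pos
    have h := tmul_dominated h1 h2 h3 h4
    change (costs (tmul u v)).Nonempty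
    exact ⟨_, 1, fun _ => a, fun _ => b, fun _ => nonneg_of_abs_le h1 h2,
      fun _ => nonneg_of_abs_le h3 h4, by simpa using h.1, by simpa using h.2, rfl⟩
  · obtain ⟨r, hr⟩ := hx
    obtain ⟨s, hs⟩ := hy
    exact ⟨r + s, costs_add hr hs⟩

theorem exists_cost_lt (x : AlgTensor U V) {ε : ℝ} (hε : 0 < ε) :
    ∃ r ∈ costs x, r < posProjNorm x + ε :=
  exists_lt_of_csInf_lt (costs_nonempty x) (lt_add_of_pos_right _ hε)

theorem posProjNorm_le {x : AlgTensor U V} {r : ℝ} (hr : r ∈ costs x) : posProjNorm x ≤ r :=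
  csInf_le (bddBelow_costs x) hr

theorem posProjNorm_nonneg (x : AlgTensor U V) : 0 ≤ posProjNorm x :=
  Real.sInf_nonneg fun _ => costs_nonneg

noncomputable instance : SeminormedAddCommGroup (AlgTensor U V) :=
  AddGroupSeminorm.toSeminormedAddCommGroup
    { toFun := posProjNorm
      map_zero' := le_antisymm (posProjNorm_le zero_mem_costs) (posProjNorm_nonneg _)
      add_le' := fun x y => by
        refine le_of_forall_pos_le_add fun ε hε => ?_
        obtain ⟨r, hr, h1⟩ := exists_cost_lt x (half_pos hε)
        obtain ⟨s, hs, h2⟩ := exists_cost_lt y (half_pos hε)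
        linarith [posProjNorm_le (costs_add hr hs)]
      neg' := fun x => by
        have h : costs (-x) = costs x :=
          Set.Subset.antisymm (fun r hr => by simpa using costs_neg hr) fun r hr => costs_neg hr
        simp only [posProjNorm, h] }

theorem norm_def (x : AlgTensor U V) : ‖x‖ = posProjNorm x := rfl

noncomputable instance : NormedSpace ℝ (AlgTensor U V) where
  norm_smul_le c x := by
    have key : ∀ {c : ℝ} (x : AlgTensor U V), 0 ≤ c → ‖c • x‖ ≤ c * ‖x‖ := fun {c} x hc => by
      refine le_of_forall_pos_le_add fun ε hε => ?_
      obtain ⟨r, hr, h1⟩ := exists_cost_lt x (ε := ε / (c + 1)) (by positivity)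
      have h2 := posProjNorm_le (costs_smul_nonneg hc hr)
      have h3 : c * (ε / (c + 1)) ≤ ε := by
        rw [mul_div_assoc', div_le_iff₀ (by positivity)]
        nlinarith
      rw [norm_def, norm_def]
      nlinarith [mul_le_mul_of_nonneg_left h1.le hc]
    rcases le_total 0 c with hc | hc
    · rw [Real.norm_of_nonneg hc]; exact key x hc
    · rw [Real.norm_of_nonpos hc, ← norm_neg, ← neg_smul]; exact key x (by linarith)

/-- The norm is monotone on the cone, in the form of the first regularity axiom. -/
theorem norm_le_of_mem_cone {x y : AlgTensor U V} (h1 : y + x ∈ cone U V)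
    (h2 : y - x ∈ cone U V) : ‖x‖ ≤ ‖y‖ := by
  refine le_csInf (costs_nonempty y) ?_
  rintro _ ⟨n, u, v, hu, hv, h3, h4, rfl⟩
  refine posProjNorm_le ⟨n, u, v, hu, hv, ?_, ?_, rfl⟩
  · convert add_mem h4 h1 using 1; abel
  · convert add_mem h4 h2 using 1; abel

theorem exists_dominating (x : AlgTensor U V) {ε : ℝ} (hε : 0 < ε) :
    ∃ y : AlgTensor U V, y + x ∈ cone U V ∧ y - x ∈ cone U V ∧ ‖y‖ < ‖x‖ + ε := by
  obtain ⟨r, ⟨n, u, v, hu, hv, h1, h2, rfl⟩, hr⟩ := exists_cost_lt x hε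
  have hy : ∑ i, tmul (u i) (v i) ∈ cone U V :=
    sum_mem fun i _ => tmul_mem_cone (hu i) (hv i)
  refine ⟨∑ i, tmul (u i) (v i), ?_, h2, lt_of_le_of_lt (posProjNorm_le
    ⟨n, u, v, hu, hv, ?_, ?_, rfl⟩) hr⟩
  · convert h1 using 1; abel
  · convert add_mem hy hy using 1; abel
  · rw [sub_self]; exact zero_mem _

end AlgTensor

variable (U V)

/-- The completion of the algebraic tensor product for the positive projective norm. -/
def Tensor : Type := UniformSpace.Completion (AlgTensor U V)

noncomputable instance : NormedAddCommGroup (Tensor U V) :=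
  inferInstanceAs (NormedAddCommGroup (UniformSpace.Completion (AlgTensor U V)))
noncomputable instance : NormedSpace ℝ (Tensor U V) :=
  inferInstanceAs (NormedSpace ℝ (UniformSpace.Completion (AlgTensor U V)))
instance : CompleteSpace (Tensor U V) :=
  inferInstanceAs (CompleteSpace (UniformSpace.Completion (AlgTensor U V)))

variable {U V}

/-- The canonical map into the completion. -/
noncomputable def Tensor.mk (x : AlgTensor U V) : Tensor U V := (x : UniformSpace.Completion (AlgTensor U V))

variable (U V)

/-- The positive cone of the completion: the norm closure of the algebraic cone. -/
noncomputable def Tensor.cone : Set (Tensor U V) := closure (Tensor.mk '' (AlgTensor.cone U V : Set _))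

variable {U V}

namespace Tensor

theorem norm_mk (x : AlgTensor U V) : ‖mk x‖ = ‖x‖ := UniformSpace.Completion.norm_coe x

theorem mk_add (x y : AlgTensor U V) : mk (x + y) = mk x + mk y :=
  UniformSpace.Completion.coe_add x y

theorem mk_sub (x y : AlgTensor U V) : mk (x - y) = mk x - mk y :=
  UniformSpace.Completion.coe_sub x y

theorem mk_smul (c : ℝ) (x : AlgTensor U V) : mk (c • x) = c • mk x :=
  UniformSpace.Completion.coe_smul c x

theorem mk_zero : mk (0 : AlgTensor U V) = 0 := UniformSpace.Completion.coe_zero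

theorem denseRange_mk : DenseRange (mk : AlgTensor U V → Tensor U V) :=
  UniformSpace.Completion.denseRange_coe

theorem mk_mem_cone {x : AlgTensor U V} (hx : x ∈ AlgTensor.cone U V) : mk x ∈ cone U V :=
  subset_closure ⟨x, hx, rfl⟩

theorem zero_mem_cone : (0 : Tensor U V) ∈ cone U V := by
  rw [← mk_zero]; exact mk_mem_cone (zero_mem _)

theorem exists_seq_of_mem_cone {z : Tensor U V} (hz : z ∈ cone U V) :
    ∃ p : ℕ → AlgTensor U V, (∀ n, p n ∈ AlgTensor.cone U V) ∧
      Tendsto (fun n => mk (p n)) atTop (𝓝 z) := by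
  obtain ⟨f, hf, h⟩ := mem_closure_iff_seq_limit.1 hz
  choose p hp hpf using hf
  exact ⟨p, hp, by simpa only [hpf] using h⟩

theorem add_mem_cone {x y : Tensor U V} (hx : x ∈ cone U V) (hy : y ∈ cone U V) :
    x + y ∈ cone U V := by
  obtain ⟨p, hp, hpx⟩ := exists_seq_of_mem_cone hx
  obtain ⟨q, hq, hqy⟩ := exists_seq_of_mem_cone hy
  exact isClosed_closure.mem_of_tendsto (hpx.add hqy)
    (Eventually.of_forall fun n => by rw [← mk_add]; exact mk_mem_cone (add_mem (hp n) (hq n)))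

theorem smul_mem_cone {c : ℝ} (hc : 0 ≤ c) {x : Tensor U V} (hx : x ∈ cone U V) :
    c • x ∈ cone U V := by
  obtain ⟨p, hp, hpx⟩ := exists_seq_of_mem_cone hx
  exact isClosed_closure.mem_of_tendsto (hpx.const_smul c)
    (Eventually.of_forall fun n => by
      rw [← mk_smul]; exact mk_mem_cone (AlgTensor.smul_mem_cone hc (hp n)))

theorem norm_le_of_mem_cone {x y : Tensor U V} (h1 : y + x ∈ cone U V) (h2 : y - x ∈ cone U V) :
    ‖x‖ ≤ ‖y‖ := by
  obtain ⟨p, hp, hpx⟩ := exists_seq_of_mem_cone h1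
  obtain ⟨q, hq, hqy⟩ := exists_seq_of_mem_cone h2
  have e1 : (y + x) - (y - x) = (2 : ℝ) • x := by rw [two_smul]; abel
  have e2 : (y + x) + (y - x) = (2 : ℝ) • y := by rw [two_smul]; abel
  have l1 := (hpx.sub hqy).norm
  have l2 := (hpx.add hqy).norm
  rw [e1, norm_smul] at l1
  rw [e2, norm_smul] at l2
  have h := le_of_tendsto_of_tendsto' l1 l2 fun n => by
    rw [← mk_sub, ← mk_add, norm_mk, norm_mk]
    refine AlgTensor.norm_le_of_mem_cone ?_ ?_
    · convert add_mem (hp n) (hp n) using 1; abel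
    · convert add_mem (hq n) (hq n) using 1; abel
  norm_num at h
  exact h

/-- `x ≤ y` means that `y - x` lies in the positive cone. -/
noncomputable instance : PartialOrder (Tensor U V) where
  le x y := y - x ∈ cone U V
  le_refl x := by rw [sub_self]; exact zero_mem_cone
  le_trans x y z h1 h2 := by
    have := add_mem_cone h2 h1
    rwa [sub_add_sub_cancel] at this
  le_antisymm x y h1 h2 := by
    have h : ‖y - x‖ ≤ ‖(0 : Tensor U V)‖ :=
      norm_le_of_mem_cone (by simpa using h1) (by simpa using h2)
    rw [norm_zero, norm_le_zero_iff, sub_eq_zero] at h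
    exact h.symm

theorem le_def (x y : Tensor U V) : x ≤ y ↔ y - x ∈ cone U V := Iff.rfl

theorem exists_dominating (x : Tensor U V) {ε : ℝ} (hε : 0 < ε) :
    ∃ y : Tensor U V, y + x ∈ cone U V ∧ y - x ∈ cone U V ∧ ‖y‖ ≤ ‖x‖ + ε := by
  have hx : x ∈ closure (Set.range (mk : AlgTensor U V → Tensor U V)) := by
    rw [denseRange_mk.closure_range]; trivial
  let b : ℕ → ℝ := fun n => ε / 8 * (1 / 2) ^ n
  have hb : ∀ n, 0 < b n := fun n => by positivity
  let mkHom : AlgTensor U V →+ Tensor U V := ⟨⟨mk, mk_zero⟩, mk_add⟩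
  obtain ⟨v, hv, hv0, hvn⟩ := controlled_sum_of_mem_closure_range (j := mkHom) hx hb
  choose y hy1 hy2 hy3 using fun n => AlgTensor.exists_dominating (v n) (hb n)
  let g : ℕ → ℝ := fun n => 2 * b n + if n = 0 then ‖x‖ else 0
  have hg : HasSum g (ε / 2 + ‖x‖) := by
    have h1 : HasSum (fun n => 2 * b n) (ε / 2) := by
      have := ((hasSum_geometric_of_lt_one (r := (1 / 2 : ℝ)) (by norm_num)
        (by norm_num)).mul_left (ε / 8)).mul_left 2
      rwa [show 2 * (ε / 8 * (1 - 1 / 2)⁻¹) = ε / 2 by ring] at this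
    exact h1.add (hasSum_ite_eq 0 ‖x‖)
  have hyg : ∀ n, ‖mk (y n)‖ ≤ g n := fun n => by
    rw [norm_mk]
    refine (hy3 n).le.trans ?_
    rcases Nat.eq_zero_or_pos n with rfl | hn
    · have h : ‖v 0‖ ≤ ‖x‖ + b 0 := by
        rw [← norm_mk]
        have h' := norm_le_norm_add_norm_sub x (mk (v 0))
        have h'' : ‖-mk (v 0) + x‖ < b 0 := hv0
        rw [neg_add_eq_sub] at h''
        linarith [norm_sub_rev x (mk (v 0))]
      simp only [g, if_true]
      linarith
    · have h : ‖v n‖ < b n := by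
        rw [← norm_mk]; exact hvn n hn
      simp only [g, hn.ne', if_false]
      linarith
  have hsum : Summable fun n => mk (y n) := Summable.of_norm_bounded hg.summable hyg
  have hlim : Tendsto (fun n => ∑ i ∈ Finset.range (n + 1), mk (y i)) atTop
      (𝓝 (∑' n, mk (y n))) :=
    hsum.hasSum.tendsto_sum_nat.comp (tendsto_add_atTop_nat 1)
  refine ⟨∑' n, mk (y n), ?_, ?_, ?_⟩
  · refine isClosed_closure.mem_of_tendsto (hlim.add hv) (Eventually.of_forall fun n => ?_)
    have : ∑ i ∈ Finset.range (n + 1), mk (y i) + ∑ i ∈ Finset.range (n + 1), mkHom (v i)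
        = mkHom (∑ i ∈ Finset.range (n + 1), (y i + v i)) := by
      rw [map_sum, ← Finset.sum_add_distrib]
      exact Finset.sum_congr rfl fun i _ => (mk_add _ _).symm
    rw [this]
    exact mk_mem_cone (sum_mem fun i _ => hy1 i)
  · refine isClosed_closure.mem_of_tendsto (hlim.sub hv) (Eventually.of_forall fun n => ?_)
    have : ∑ i ∈ Finset.range (n + 1), mk (y i) - ∑ i ∈ Finset.range (n + 1), mkHom (v i)
        = mkHom (∑ i ∈ Finset.range (n + 1), (y i - v i)) := by
      rw [map_sum, ← Finset.sum_sub_distrib]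
      exact Finset.sum_congr rfl fun i _ => (mk_sub _ _).symm
    rw [this]
    exact mk_mem_cone (sum_mem fun i _ => hy2 i)
  · have := tsum_of_norm_bounded hg hyg
    linarith

noncomputable instance : RegularOrderedBanach (Tensor U V) where
  add_le_add_right' u v w h := by
    rw [le_def] at h ⊢
    rwa [add_sub_add_right_eq_sub]
  smul_le_smul' c u v hc h := by
    rw [le_def] at h ⊢
    rw [← smul_sub]
    exact smul_mem_cone hc h
  complete := inferInstance
  isClosed_cone := by
    have : {v : Tensor U V | 0 ≤ v} = cone U V := by
      ext v
      simp [le_def]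
    rw [this]
    exact isClosed_closure
  norm_le_of_abs_le x y h1 h2 := by
    rw [le_def] at h1 h2
    exact norm_le_of_mem_cone (by simpa [add_comm] using h1) h2
  isGLB_norm x := by
    refine ⟨?_, fun r hr => le_of_forall_pos_le_add fun ε hε => ?_⟩
    · rintro _ ⟨y, h1, h2, rfl⟩
      rw [le_def] at h1 h2
      exact norm_le_of_mem_cone (by simpa [add_comm] using h1) h2
    · obtain ⟨y, h1, h2, h3⟩ := exists_dominating x hε
      exact (hr ⟨y, by rw [le_def]; simpa [add_comm] using h1, h2, rfl⟩).trans h3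

end Tensor

end Tensor

/-- The positive projective tensor product of two regular ordered Banach spaces. -/
noncomputable def RoBan.tensor (U V : RoBan) : RoBan := ⟨Tensor U V⟩

/-! ### Measure types -/

/-- The measure types, indexed by their denotation: a term of `MeasureType V` is a measure type
`T` with denotation `⟦T⟧ = V`. Indexing by the denotation implements the simultaneous definition
of the types and of their semantics, which the prior `μ ∈ ⟦T⟧` in a Bayesian type calls for. -/
inductive MeasureType : RoBan → Type 1
  /-- `⟦m⟧ = 𝓜 {1, …, m}` -/
  | fin (m : ℕ) (hm : 1 ≤ m) : MeasureType (RoBan.measures (Fin m))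
  /-- `⟦intⁿ⟧ = 𝓜 (ℕⁿ)` -/
  | int (n : ℕ) (hn : 1 ≤ n) : MeasureType (RoBan.measures (Fin n → ℕ))
  /-- `⟦realⁿ⟧ = 𝓜 (ℝⁿ)` -/
  | real (n : ℕ) (hn : 1 ≤ n) : MeasureType (RoBan.measures (Fin n → ℝ))
  /-- `⟦PosDef(n)⟧ = 𝓜 (PosDef(n))`, for the Borel sets of the space of positive semidefinite
  `n × n` matrices -/
  | posDef (n : ℕ) (hn : 1 ≤ n) :
      MeasureType (@RoBan.measures {A : Matrix (Fin n) (Fin n) ℝ // A.PosSemidef} (borel _))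
  /-- `⟦(T, μ)⟧ = ⟦T⟧_μ`, the principal band generated by the prior `μ` -/
  | bayes {V : RoBan} (T : MeasureType V) (μ : V) : MeasureType (V.band μ)
  /-- `⟦S ⊗ T⟧ = ⟦S⟧ ⊗ ⟦T⟧`, the positive projective tensor product -/
  | tensor {U V : RoBan} (S : MeasureType U) (T : MeasureType V) : MeasureType (U.tensor V)
  /-- `⟦M T⟧ = 𝓜 ⟦T⟧`, for the Borel sets of the norm topology -/
  | measures {V : RoBan} (T : MeasureType V) : MeasureType (@RoBan.measures V (borel V))

/-- The denotation of a measure type. -/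
def MeasureType.den {V : RoBan} (_ : MeasureType V) : RoBan := V

end MeasSem

/-! The proof is an induction on the type, for a stronger statement: `⟦T⟧` embeds isometrically into
some `𝓜 X`, preserving and reflecting order, with range an order ideal (`IsSolidEmbedding`). The
ideal property makes `⟦T⟧` a Riesz space, since the modulus of `J x` lies below some `J y` and so
comes from `⟦T⟧`. It also passes to bands by restriction. For ground types and `M T` the embedding
is the identity.

The substance is the tensor product, mapped to measures on `X × Y` by `u ⊗ v ↦ J u × K v`. This map
is positive and contractive because norms of positive measures multiply under products. For the
converse bound, Radon–Nikodym and simple functions approximate a tensor by `∑ a_c ⊗ w_c` with `a_c ≥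
0` carried by disjoint sets `A_c`. With Jordan decompositions `w_c = p_c - n_c` and Hahn sets `P_c`,
put `t = ∑ a_c ⊗ p_c` and `r = ∑ a_c ⊗ n_c`. The norms of `t` and `r` are at most the values of the
image measure, up to sign, on the disjoint sets `⋃ A_c × P_c` and `⋃ A_c × P_cᶜ`
(`exists_jordan_approx`). Hence `‖t‖ + ‖r‖` is at most the total variation, which gives the isometry
(`norm_algProd`). If the image of the tensor is positive, `r` must be small, which gives reflection
of order (`nonneg_of_tensorProd_nonneg`).

The range is an order ideal because it is closed and contains the restrictions of `J a × K b` to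
rectangles, hence by a π-λ argument to all measurable sets, hence every measure with a density
(`mem_range_of_le_signedProd`). Truncation extends this from products to arbitrary dominating
elements (`mem_range_of_le_tensorProd`). -/

namespace MeasSem

/-! ### Lattice operations from moduli -/

section Riesz

variable {V : Type} [NormedAddCommGroup V] [NormedSpace ℝ V] [PartialOrder V]
  [RegularOrderedBanach V]

theorem le_half_smul_iff (x y : V) : x ≤ (1 / 2 : ℝ) • y ↔ x + x ≤ y := by
  have hx : ∀ z : V, (1 / 2 : ℝ) • (z + z) = z := fun z => by
    rw [← two_smul ℝ z, smul_smul]; norm_num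
  constructor <;> intro h
  · have := RegularOrderedBanach.smul_le_smul' 2 _ _ zero_le_two h
    rwa [smul_smul, two_smul, mul_one_div_cancel two_ne_zero, one_smul] at this
  · have := RegularOrderedBanach.smul_le_smul' (1 / 2) _ _ (by norm_num) h
    rwa [hx] at this

theorem half_smul_le_iff (x y : V) : (1 / 2 : ℝ) • x ≤ y ↔ x ≤ y + y := by
  rw [← neg_le_neg_iff, ← smul_neg, le_half_smul_iff, ← neg_add, neg_le_neg_iff]

theorem isLUB_half_add_modulus {x y a : V} (ha : IsLUB {x - y, -(x - y)} a) :
    IsLUB {x, y} ((1 / 2 : ℝ) • (x + y + a)) := by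
  have h1 : x - y ≤ a := ha.1 (by simp)
  have h2 : -(x - y) ≤ a := ha.1 (by simp)
  refine ⟨?_, fun z hz => ?_⟩
  · intro w hw
    rw [le_half_smul_iff]
    obtain rfl | rfl := hw
    · convert add_le_add_right h1 (w + y) using 1; abel
    · convert add_le_add_right h2 (x + w) using 1; abel
  · have hx : x ≤ z := hz (by simp)
    have hy : y ≤ z := hz (by simp)
    rw [half_smul_le_iff, ← le_sub_iff_add_le']
    refine ha.2 ?_
    rintro _ (rfl | rfl) <;> rw [← sub_nonneg]
    · convert add_nonneg (sub_nonneg.2 hx) (sub_nonneg.2 hx) using 1; abel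
    · convert add_nonneg (sub_nonneg.2 hy) (sub_nonneg.2 hy) using 1; abel

/-- Suprema come from `x ⊔ y = (x + y + |x - y|) / 2` and infima from `x ⊓ y = -(-x ⊔ -y)`, so later
only moduli have to be produced. -/
theorem isRiesz_of_forall_exists_modulus (h : ∀ x : V, ∃ a, IsLUB {x, -x} a) : IsRiesz V := by
  have hs : ∀ x y : V, ∃ s, IsLUB {x, y} s := fun x y => by
    obtain ⟨a, ha⟩ := h (x - y)
    exact ⟨_, isLUB_half_add_modulus ha⟩
  refine fun x y => ⟨hs x y, ?_⟩
  obtain ⟨s, hs⟩ := hs (-x) (-y)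
  refine ⟨-s, ?_, fun z hz => ?_⟩
  · rintro _ (rfl | rfl)
    · exact neg_le.1 (hs.1 (by simp))
    · exact neg_le.1 (hs.1 (by simp))
  · refine le_neg.1 (hs.2 ?_)
    rintro _ (rfl | rfl)
    · exact neg_le_neg (hz (by simp))
    · exact neg_le_neg (hz (by simp))

/-- The witness is the truncation `z ⊓ x`; since `x = y ⊓ x`, the estimate says that `· ⊓ x` is
nonexpansive. It serves to truncate a dominated measure when its bound is replaced by an
approximation. -/
theorem exists_nonneg_le_of_le (hV : IsRiesz V) {x y z : V} (hx : 0 ≤ x) (hxy : x ≤ y)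
    (hz : 0 ≤ z) : ∃ w : V, 0 ≤ w ∧ w ≤ z ∧ ‖x - w‖ ≤ ‖y - z‖ := by
  let _ : Lattice V := hV.lattice
  have habs : ∀ x : V, IsLUB {x, -x} |x| := fun x => isLUB_pair
  have : HasSolidNorm V := ⟨fun x y h => by
    rw [← norm_modulus (habs x), ← norm_modulus (habs y)]
    exact RegularOrderedBanach.norm_le_of_abs_le _ _
      ((neg_nonpos.2 (abs_nonneg _)).trans (abs_nonneg _)) h⟩
  refine ⟨z ⊓ x, le_inf hz hx, inf_le_left, ?_⟩
  calc ‖x - z ⊓ x‖ = ‖y ⊓ x - z ⊓ x‖ := by rw [inf_eq_right.2 hxy]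
    _ ≤ ‖y - z‖ := norm_inf_sub_inf_le_norm _ _ _

end Riesz

/-! ### Order and norm of signed measures -/

section Measures

variable {X : Type} [MeasurableSpace X]

/-- Evaluation of signed measures at a fixed set. -/
noncomputable def evalCLM (A : Set X) : SignedMeasure X →L[ℝ] ℝ :=
  LinearMap.mkContinuous
    { toFun := fun μ => μ A
      map_add' := fun μ ν => by simp
      map_smul' := fun c μ => by simp } 1 fun μ => by simpa using abs_apply_le_norm μ A

theorem evalCLM_apply (A : Set X) (μ : SignedMeasure X) : evalCLM A μ = μ A := rfl

theorem signedMeasure_finset_sum_apply {ι : Type*} (s : Finset ι) (μ : ι → SignedMeasure X)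
    (A : Set X) : (∑ i ∈ s, μ i) A = ∑ i ∈ s, μ i A :=
  map_sum (evalCLM A) μ s

/-- This trades a positive signed measure for a finite measure, which can then be restricted,
multiplied and used as a reference for densities. -/
theorem toSignedMeasure_variation_of_nonneg {μ : SignedMeasure X} (h : 0 ≤ μ) :
    μ.variation.toSignedMeasure = μ := by
  have h' := (VectorMeasure.le_restrict_univ_iff_le (0 : SignedMeasure X) μ).2 h
  rw [← SignedMeasure.toMeasureOfZeroLE_toSignedMeasure μ h']
  exact Measure.toSignedMeasure_congr Measure.variation_toSignedMeasure

theorem norm_of_nonneg {μ : SignedMeasure X} (h : 0 ≤ μ) : ‖μ‖ = μ Set.univ := by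
  conv_rhs => rw [← toSignedMeasure_variation_of_nonneg h]
  rw [Measure.toSignedMeasure_apply_measurable MeasurableSet.univ]
  rfl

theorem signedMeasure_mono {μ : SignedMeasure X} (h : 0 ≤ μ) {A B : Set X} (hA : MeasurableSet A)
    (hB : MeasurableSet B) (hAB : A ⊆ B) : μ A ≤ μ B := by
  rw [← VectorMeasure.of_add_of_sdiff hA hB hAB]
  exact le_add_of_nonneg_right (h _ (hB.diff hA))

/-- An upper bound `ν` of `±μ` is positive, hence equal to its own variation, and it bounds `|μ E|`
on every measurable `E`; the variation of `μ` is the least measure that does so. -/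
theorem isLUB_variation (μ : SignedMeasure X) : IsLUB {μ, -μ} μ.variation.toSignedMeasure := by
  constructor
  · rintro _ (rfl | rfl) <;> intro A hA <;>
    rw [Measure.toSignedMeasure_apply_measurable hA]
    · exact (le_abs_self _).trans (abs_apply_le_variation _ A)
    · exact (neg_le_abs _).trans (abs_apply_le_variation _ A)
  · intro ν hν
    have h1 : μ ≤ ν := hν (by simp)
    have h2 : -μ ≤ ν := hν (by simp)
    have h0 : 0 ≤ ν := nonneg_of_abs_le (neg_le.1 h2) h1
    rw [← toSignedMeasure_variation_of_nonneg h0, Measure.toSignedMeasure_le_toSignedMeasure_iff]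
    refine VectorMeasure.variation_le_of_forall_enorm_le fun E hE => ?_
    rw [← ENNReal.ofReal_toReal (measure_ne_top ν.variation E), ← ofReal_norm]
    refine ENNReal.ofReal_le_ofReal
      (le_trans ?_ ((le_abs_self _).trans (abs_apply_le_variation ν E)))
    exact abs_le.2 ⟨by simpa [neg_le] using h2 E hE, h1 E hE⟩

theorem isRiesz_signedMeasure : IsRiesz (SignedMeasure X) :=
  isRiesz_of_forall_exists_modulus fun μ => ⟨_, isLUB_variation μ⟩

/-- The lower bound for total variation that will be applied to an approximate Hahn decomposition of
a product. -/
theorem abs_apply_add_abs_apply_le_norm (μ : SignedMeasure X) {A B : Set X} (hAB : Disjoint A B)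
    (hB : MeasurableSet B) : |μ A| + |μ B| ≤ ‖μ‖ := by
  refine (add_le_add (abs_apply_le_variation μ A) (abs_apply_le_variation μ B)).trans ?_
  rw [← measureReal_union hAB hB]
  exact measureReal_mono (Set.subset_univ _)

/-- This turns approximation of densities in `L¹` into approximation of measures in total variation.
-/
theorem norm_withDensityᵥ_le {μ : Measure X} {f : X → ℝ} (hf : Integrable f μ) :
    ‖μ.withDensityᵥ f‖ ≤ ∫ x, |f x| ∂μ := by
  have hm : ∀ E, MeasurableSet E → (μ.withDensity fun x => ‖f x‖ₑ) E
      = ENNReal.ofReal (∫ x in E, |f x| ∂μ) :=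
    fun E hE => by
      rw [withDensity_apply _ hE, ofReal_integral_eq_lintegral_ofReal hf.abs.integrableOn
        (Eventually.of_forall fun _ => abs_nonneg _)]
      simp only [← Real.enorm_eq_ofReal_abs]
  have hfin : IsFiniteMeasure (μ.withDensity fun x => ‖f x‖ₑ) :=
    ⟨by rw [hm _ MeasurableSet.univ]; exact ENNReal.ofReal_lt_top⟩
  have hr : ∀ E, MeasurableSet E → (μ.withDensity fun x => ‖f x‖ₑ).real E = ∫ x in E, |f x| ∂μ :=
    fun E hE => by
      rw [measureReal_def, hm E hE, ENNReal.toReal_ofReal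
        (integral_nonneg fun _ => abs_nonneg _)]
  refine (norm_signedMeasure_le (m := μ.withDensity fun x => ‖f x‖ₑ) fun E hE => ?_).trans_eq ?_
  · rw [hr E hE, withDensityᵥ_apply hf hE]
    exact abs_integral_le_integral_abs
  · rw [hr _ MeasurableSet.univ, setIntegral_univ]

end Measures

/-! ### Embeddings onto order ideals of measures -/

/-- A linear isometry of `V` into a space of measures that is an order embedding and whose range
is an order ideal. -/
structure IsSolidEmbedding {V : RoBan} {X : Type} [MeasurableSpace X]
    (J : V →ₗᵢ[ℝ] SignedMeasure X) : Prop where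
  le_iff : ∀ x y : V, J x ≤ J y ↔ x ≤ y
  solid : ∀ (v : V) (ρ : SignedMeasure X), 0 ≤ ρ → ρ ≤ J v → ρ ∈ Set.range J

namespace IsSolidEmbedding

variable {V : RoBan} {X : Type} [MeasurableSpace X] {J : V →ₗᵢ[ℝ] SignedMeasure X}

theorem nonneg_iff (hJ : IsSolidEmbedding J) (v : V) : 0 ≤ J v ↔ 0 ≤ v := by
  rw [← hJ.le_iff, map_zero]

/-- For `y` dominating `±x`, the variation of `J x` lies below `J y`. Solidity pulls it back to `V`,
and reflection of order makes the preimage the modulus of `x`. -/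
theorem isRiesz (hJ : IsSolidEmbedding J) : IsRiesz V := by
  refine isRiesz_of_forall_exists_modulus fun x => ?_
  obtain ⟨y, h1, h2, -⟩ := exists_abs_le x one_pos
  have hlub := isLUB_variation (J x)
  obtain ⟨a, ha⟩ := hJ.solid y (J x).variation.toSignedMeasure
    (Measure.zero_le_toSignedMeasure _) (hlub.2 (by
      rintro _ (rfl | rfl)
      · exact (hJ.le_iff _ _).2 h2
      · rw [← map_neg]
        exact (hJ.le_iff _ _).2 (neg_le.1 h1)))
  rw [← ha] at hlub
  refine ⟨a, ?_, fun z hz => ?_⟩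
  · rintro _ (rfl | rfl)
    · exact (hJ.le_iff _ _).1 (hlub.1 (by simp))
    · exact (hJ.le_iff _ _).1 (hlub.1 (by simp))
  · refine (hJ.le_iff _ _).1 (hlub.2 ?_)
    rintro _ (rfl | rfl)
    · exact (hJ.le_iff _ _).2 (hz (by simp))
    · rw [← map_neg]
      exact (hJ.le_iff _ _).2 (hz (by simp))

theorem id : IsSolidEmbedding (V := RoBan.measures X)
    (LinearIsometry.id (R := ℝ) (E := SignedMeasure X)) where
  le_iff _ _ := Iff.rfl
  solid _ ρ _ _ := ⟨ρ, rfl⟩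

theorem isLUB_of_nonneg {v : V} (hv : 0 ≤ v) : IsLUB {v, -v} v := by
  refine ⟨?_, fun z hz => hz (by simp)⟩
  rintro _ (rfl | rfl)
  · exact le_rfl
  · exact (neg_nonpos.2 hv).trans hv

/-- The restriction of `J` works: a measure below the image of a band element `v` comes from some
`w` with `0 ≤ w ≤ v`, and solidity of the band puts `w` in it. -/
theorem exists_band (hJ : IsSolidEmbedding J) (μ : V) :
    ∃ J' : V.band μ →ₗᵢ[ℝ] SignedMeasure X, IsSolidEmbedding J' := by
  have h := hJ.isRiesz
  have hband := isBand_principalBand μ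
  -- The dummy branch is excluded because `V` is already known to be Riesz.
  unfold RoBan.band
  rw [dif_pos h]
  refine ⟨J.comp (principalBand μ).subtypeₗᵢ, fun x y => hJ.le_iff x y, fun v ρ h0 hρ => ?_⟩
  obtain ⟨w, rfl⟩ := hJ.solid v ρ h0 hρ
  have hw : 0 ≤ w := (hJ.nonneg_iff w).1 h0
  have hwv : w ≤ v := (hJ.le_iff _ _).1 hρ
  exact ⟨⟨w, hband.solid w v w v (isLUB_of_nonneg hw) (isLUB_of_nonneg (hw.trans hwv)) hwv v.2⟩,
    rfl⟩

end IsSolidEmbedding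

/-! ### Products of signed measures -/

section Prod

variable {X Y : Type} [MeasurableSpace X] [MeasurableSpace Y]

/-- The product of signed measures, as a bilinear map. -/
noncomputable def signedProd :
    SignedMeasure X →ₗ[ℝ] SignedMeasure Y →ₗ[ℝ] SignedMeasure (X × Y) :=
  LinearMap.mk₂ ℝ (fun μ ν => μ.prod ν (ContinuousLinearMap.mul ℝ ℝ))
    -- Each bilinearity identity need only be checked on measurable rectangles, which determine the
    -- product.
    (fun μ μ' ν => VectorMeasure.prod_eq_of_forall_apply_prod fun s t _ _ => by
      simp)
    (fun c μ ν => VectorMeasure.prod_eq_of_forall_apply_prod fun s t _ _ => by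
      simp [mul_assoc])
    (fun μ ν ν' => VectorMeasure.prod_eq_of_forall_apply_prod fun s t _ _ => by
      simp [mul_add])
    (fun c μ ν => VectorMeasure.prod_eq_of_forall_apply_prod fun s t _ _ => by
      simp [mul_left_comm])

theorem signedProd_apply_prod (μ : SignedMeasure X) (ν : SignedMeasure Y) (s : Set X)
    (t : Set Y) : signedProd μ ν (s ×ˢ t) = μ s * ν t :=
  VectorMeasure.prod_apply

theorem signedProd_eq_of_forall {μ : SignedMeasure X} {ν : SignedMeasure Y}
    {ρ : SignedMeasure (X × Y)}
    (h : ∀ s t, MeasurableSet s → MeasurableSet t → ρ (s ×ˢ t) = μ s * ν t) :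
    signedProd μ ν = ρ :=
  VectorMeasure.prod_eq_of_forall_apply_prod h

theorem signedProd_toSignedMeasure (m : Measure X) (n : Measure Y) [IsFiniteMeasure m]
    [IsFiniteMeasure n] :
    signedProd m.toSignedMeasure n.toSignedMeasure = (m.prod n).toSignedMeasure :=
  signedProd_eq_of_forall fun s t hs ht => by
    simp [hs, ht, hs.prod ht, measureReal_prod_prod]

theorem signedProd_nonneg {μ : SignedMeasure X} {ν : SignedMeasure Y} (hμ : 0 ≤ μ) (hν : 0 ≤ ν) :
    0 ≤ signedProd μ ν := by
  rw [← toSignedMeasure_variation_of_nonneg hμ, ← toSignedMeasure_variation_of_nonneg hν,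
    signedProd_toSignedMeasure]
  exact Measure.zero_le_toSignedMeasure _

/-- For positive measures the norm is the total mass, and `X × Y` is itself a rectangle. -/
theorem norm_signedProd_of_nonneg {μ : SignedMeasure X} {ν : SignedMeasure Y} (hμ : 0 ≤ μ)
    (hν : 0 ≤ ν) : ‖signedProd μ ν‖ = ‖μ‖ * ‖ν‖ := by
  rw [norm_of_nonneg hμ, norm_of_nonneg hν, norm_of_nonneg (signedProd_nonneg hμ hν),
    ← Set.univ_prod_univ, signedProd_apply_prod]

end Prod

/-! ### Radon–Nikodym densities and simple functions -/

section Density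

variable {X : Type} [MeasurableSpace X]

/-- Domination by `m` forces absolute continuity, so Radon–Nikodym applies. -/
theorem exists_density {m : Measure X} [IsFiniteMeasure m] {μ : SignedMeasure X}
    (h : ∀ A, MeasurableSet A → |μ A| ≤ m.real A) :
    ∃ f : X → ℝ, Integrable f m ∧ m.withDensityᵥ f = μ := by
  refine ⟨μ.rnDeriv m, SignedMeasure.integrable_rnDeriv _ _,
    SignedMeasure.withDensityᵥ_rnDeriv_eq μ m (VectorMeasure.AbsolutelyContinuous.mk
      fun A hA h0 => ?_)⟩
  rw [Measure.toENNRealVectorMeasure_apply_measurable hA] at h0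
  have := h A hA
  rw [measureReal_def, h0] at this
  simpa using this

theorem withDensityᵥ_indicator (m : Measure X) [IsFiniteMeasure m] (c : ℝ) {A : Set X}
    (hA : MeasurableSet A) :
    m.withDensityᵥ (A.indicator fun _ => c) = c • (m.restrict A).toSignedMeasure := by
  ext E hE
  rw [withDensityᵥ_apply ((integrable_const c).indicator hA) hE,
    setIntegral_indicator hA, smul_apply, Measure.toSignedMeasure_apply_measurable hE,
    measureReal_restrict_apply hE]
  simp [mul_comm]

/-- Finitely many densities are approximated simultaneously by combinations of the restrictions of
the reference measure to the members of one finite measurable partition. -/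
theorem exists_simple_approx (m : Measure X) [IsFiniteMeasure m] {k : ℕ} (f : Fin k → X → ℝ)
    (hf : ∀ i, Integrable (f i) m) {ε : ℝ} (hε : 0 < ε) :
    ∃ F : SimpleFunc X (Fin k → ℝ), ∀ i, ‖m.withDensityᵥ (f i) -
      ∑ c ∈ F.range, c i • (m.restrict (F ⁻¹' {c})).toSignedMeasure‖ < ε := by
  -- Bundling the densities into one `ℝᵏ`-valued function makes a single simple function, hence a
  -- single partition into its fibres, serve all of them.
  have hfi : Integrable (fun x i => f i x) m := Integrable.of_eval hf
  obtain ⟨F, hF, hFm⟩ := (memLp_one_iff_integrable.2 hfi).exists_simpleFunc_eLpNorm_sub_lt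
    ENNReal.one_ne_top (ε := ENNReal.ofReal ε) (by simpa using hε)
  refine ⟨F, fun i => ?_⟩
  have hFi : Integrable (fun x => F x i) m := (memLp_one_iff_integrable.1 hFm).eval i
  have hsum : ∑ c ∈ F.range, c i • (m.restrict (F ⁻¹' {c})).toSignedMeasure
      = m.withDensityᵥ fun x => F x i := by
    ext E hE
    rw [signedMeasure_finset_sum_apply, withDensityᵥ_apply hFi hE]
    have h := SimpleFunc.integral_eq_integral (F.map fun c : Fin k → ℝ => c i) (μ := m.restrict E)
      (show Integrable (fun x => F x i) _ from hFi.integrableOn)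
    rw [SimpleFunc.map_integral F _ (memLp_one_iff_integrable.1 hFm).integrableOn rfl] at h
    refine Eq.trans (Finset.sum_congr rfl fun c _ => ?_) h
    rw [smul_apply, Measure.toSignedMeasure_apply_measurable hE, measureReal_restrict_apply hE,
      measureReal_restrict_apply (F.measurableSet_fiber c), Set.inter_comm, smul_eq_mul, smul_eq_mul,
      mul_comm]
  rw [hsum, ← withDensityᵥ_sub' (hf i) hFi]
  refine (norm_withDensityᵥ_le ((hf i).sub hFi)).trans_lt ?_
  have hd := hfi.sub (memLp_one_iff_integrable.1 hFm)
  refine (integral_mono ((hf i).sub hFi).abs hd.norm fun x => ?_).trans_lt ?_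
  -- The sup norm on `Fin k → ℝ` controls each coordinate.
  · exact norm_le_pi_norm ((fun i => f i x) - F x) i
  · rw [eLpNorm_one_eq_lintegral_enorm, ← ofReal_integral_norm_eq_lintegral_enorm hd,
      ENNReal.ofReal_lt_ofReal_iff hε] at hF
    exact hF

end Density

/-! ### Common bounds, Jordan decompositions and step approximations -/

section Bound

variable {V : Type} [NormedAddCommGroup V] [NormedSpace ℝ V] [PartialOrder V]
  [RegularOrderedBanach V]

/-- The sum of individual bounds will provide one reference measure for all the `u i`. -/
theorem exists_common_bound {k : ℕ} (u : Fin k → V) :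
    ∃ b : V, 0 ≤ b ∧ ∀ i, -b ≤ u i ∧ u i ≤ b := by
  choose y hy1 hy2 hy3 using fun i => exists_abs_le (u i) one_pos
  have hy0 : ∀ i, 0 ≤ y i := fun i => nonneg_of_abs_le (hy1 i) (hy2 i)
  have hle : ∀ i, y i ≤ ∑ j, y j := fun i =>
    Finset.single_le_sum (fun j _ => hy0 j) (Finset.mem_univ i)
  exact ⟨∑ i, y i, Finset.sum_nonneg fun i _ => hy0 i,
    fun i => ⟨(neg_le_neg (hle i)).trans (hy1 i), (hy2 i).trans (hle i)⟩⟩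

end Bound

namespace IsSolidEmbedding

variable {V : RoBan} {X : Type} [MeasurableSpace X] {J : V →ₗᵢ[ℝ] SignedMeasure X}

/-- The Jordan decomposition of an element of a solidly embedded space. -/
theorem exists_jordan (hJ : IsSolidEmbedding J) (w : V) :
    ∃ (p n : V) (P : Set X), 0 ≤ p ∧ 0 ≤ n ∧ w = p - n ∧ MeasurableSet P ∧
      ‖p‖ = J w P ∧ ‖n‖ = -J w Pᶜ := by
  obtain ⟨P, hP, h1, h2⟩ := SignedMeasure.exists_compl_positive_negative (J w)
  obtain ⟨y, hy1, hy2, -⟩ := exists_abs_le w one_pos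
  have hy0 : 0 ≤ J y := (hJ.nonneg_iff y).2 (nonneg_of_abs_le hy1 hy2)
  have hp0 : 0 ≤ (J w).restrict P := by
    intro A hA
    simpa using h1 A hA
  have hn0 : 0 ≤ -(J w).restrict Pᶜ := by
    intro A hA
    simpa using h2 A hA
  -- On subsets of the Hahn set `P`, `J w ≤ J y`, and `J y` is positive elsewhere; so the positive
  -- part of `J w` lies below `J y` and has a preimage.
  obtain ⟨p, hp⟩ := hJ.solid y ((J w).restrict P) hp0 fun A hA => by
    rw [VectorMeasure.restrict_apply _ hP hA]
    exact ((hJ.le_iff _ _).2 hy2 _ (hA.inter hP)).trans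
      (signedMeasure_mono hy0 (hA.inter hP) hA Set.inter_subset_left)
  -- The negative part needs no second lifting: it is the image of `p - w`.
  have hn : J (p - w) = -(J w).restrict Pᶜ := by
    rw [map_sub, hp, sub_eq_iff_eq_add, neg_add_eq_sub, eq_sub_iff_add_eq]
    exact VectorMeasure.restrict_add_restrict_compl hP
  refine ⟨p, p - w, P, (hJ.nonneg_iff _).1 (hp ▸ hp0), (hJ.nonneg_iff _).1 (hn ▸ hn0), by abel, hP,
    ?_, ?_⟩
  · rw [← J.norm_map, hp, norm_of_nonneg hp0, VectorMeasure.restrict_apply _ hP .univ,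
      Set.univ_inter]
  · rw [← J.norm_map, hn, norm_of_nonneg hn0, neg_apply,
      VectorMeasure.restrict_apply _ hP.compl .univ, Set.univ_inter]

/-- The index `c` runs over values of an `ℝᵏ`-valued simple function, so its coordinates are the
coefficients. The restrictions of `J b` to the fibres, for a common bound `b`, lie below `J b` and
therefore come from elements `a c` of `V`. -/
theorem exists_step_approx (hJ : IsSolidEmbedding J) {k : ℕ} (u : Fin k → V) {ε : ℝ}
    (hε : 0 < ε) :
    ∃ (s : Finset (Fin k → ℝ)) (A : (Fin k → ℝ) → Set X) (a : (Fin k → ℝ) → V),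
      (∀ c, MeasurableSet (A c)) ∧ Pairwise (Function.onFun Disjoint A) ∧ (∀ c, 0 ≤ a c) ∧
      (∀ c, J (a c) (A c)ᶜ = 0) ∧ ∀ i, ‖u i - ∑ c ∈ s, c i • a c‖ < ε := by
  obtain ⟨b, hb0, hb⟩ := exists_common_bound u
  have hJb := (hJ.nonneg_iff b).2 hb0
  set m := (J b).variation with hm
  have hmb : m.toSignedMeasure = J b := toSignedMeasure_variation_of_nonneg hJb
  choose f hf hfu using fun i => exists_density (m := m) (μ := J (u i)) fun A hA => by
    rw [← Measure.toSignedMeasure_apply_measurable hA, hmb, abs_le]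
    have h1 := (hJ.le_iff _ _).2 (hb i).1 A hA
    rw [map_neg, neg_apply] at h1
    exact ⟨h1, (hJ.le_iff _ _).2 (hb i).2 A hA⟩
  obtain ⟨F, hF⟩ := exists_simple_approx m f hf hε
  choose a ha using fun c => hJ.solid b (m.restrict (F ⁻¹' {c})).toSignedMeasure
    (Measure.zero_le_toSignedMeasure _) (by
      refine le_of_le_of_eq ?_ hmb
      rw [Measure.toSignedMeasure_le_toSignedMeasure_iff]
      exact Measure.restrict_le_self)
  refine ⟨F.range, fun c => F ⁻¹' {c}, a, fun c => F.measurableSet_fiber c, fun c d hcd => ?_,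
    fun c => (hJ.nonneg_iff _).1 (ha c ▸ Measure.zero_le_toSignedMeasure _), fun c => ?_,
    fun i => ?_⟩
  · exact Disjoint.preimage _ (by simpa using hcd)
  · rw [ha, Measure.toSignedMeasure_apply_measurable (F.measurableSet_fiber c).compl,
      measureReal_restrict_apply (F.measurableSet_fiber c).compl]
    simp
  · rw [← J.norm_map, map_sub, map_sum, ← hfu]
    simp only [map_smul, ha]
    exact hF i

end IsSolidEmbedding

/-! ### The product map on the algebraic tensor product -/

section

variable {U V : RoBan} {X Y : Type} [MeasurableSpace X] [MeasurableSpace Y]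

/-- A positive elementary tensor dominates itself, so its own cost is admissible in the infimum. -/
theorem AlgTensor.norm_sum_tmul_le_of_nonneg {ι : Type*} (s : Finset ι) {u : ι → U} {v : ι → V}
    (hu : ∀ i, 0 ≤ u i) (hv : ∀ i, 0 ≤ v i) :
    ‖∑ i ∈ s, tmul (u i) (v i)‖ ≤ ∑ i ∈ s, ‖u i‖ * ‖v i‖ := by
  refine (norm_sum_le _ _).trans (Finset.sum_le_sum fun i _ => ?_)
  refine posProjNorm_le ⟨1, fun _ => u i, fun _ => v i, fun _ => hu i, fun _ => hv i, ?_, ?_, ?_⟩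
  · simpa using add_mem (tmul_mem_cone (hu i) (hv i)) (tmul_mem_cone (hu i) (hv i))
  · simp
  · simp

theorem AlgTensor.norm_tmul_le (u : U) (v : V) : ‖tmul u v‖ ≤ ‖u‖ * ‖v‖ := by
  -- Dominating elements have norms only approximately those of `u` and `v`; the slack `1 / (n + 1)`
  -- is removed in the limit.
  have h : ∀ n : ℕ, ‖tmul u v‖ ≤ (‖u‖ + 1 / (n + 1)) * (‖v‖ + 1 / (n + 1)) := fun n => by
    obtain ⟨a, h1, h2, ha⟩ := exists_abs_le u (ε := 1 / ((n : ℝ) + 1)) (by positivity)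
    obtain ⟨b, h3, h4, hb⟩ := exists_abs_le v (ε := 1 / ((n : ℝ) + 1)) (by positivity)
    obtain ⟨h5, h6⟩ := tmul_dominated h1 h2 h3 h4
    refine le_trans (posProjNorm_le ⟨1, fun _ => a, fun _ => b, fun _ => nonneg_of_abs_le h1 h2,
      fun _ => nonneg_of_abs_le h3 h4, by simpa using h5, by simpa using h6, rfl⟩) ?_
    simp only [Finset.univ_unique, Finset.sum_const, Finset.card_singleton, one_smul]
    gcongr
  have h0 := tendsto_one_div_add_atTop_nhds_zero_nat (𝕜 := ℝ)
  refine ge_of_tendsto' (x := atTop) ?_ h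
  simpa using (h0.const_add ‖u‖).mul (h0.const_add ‖v‖)

theorem AlgTensor.sum_tmul {ι : Type*} (s : Finset ι) (u : ι → U) (v : V) :
    tmul (∑ i ∈ s, u i) v = ∑ i ∈ s, tmul (u i) v :=
  TensorProduct.sum_tmul s u v

theorem AlgTensor.tmul_sum {ι : Type*} (s : Finset ι) (u : U) (v : ι → V) :
    tmul u (∑ i ∈ s, v i) = ∑ i ∈ s, tmul u (v i) :=
  TensorProduct.tmul_sum u s v

theorem AlgTensor.exists_eq_sum_tmul (x : AlgTensor U V) :
    ∃ (k : ℕ) (u : Fin k → U) (v : Fin k → V), x = ∑ i, tmul (u i) (v i) :=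
  TensorProduct.exists_sum_tmul_eq (R := ℝ) (M := U) (N := V) x

variable (J : U →ₗᵢ[ℝ] SignedMeasure X) (K : V →ₗᵢ[ℝ] SignedMeasure Y)

/-- The map `u ⊗ v ↦ J u × K v` on the algebraic tensor product. -/
noncomputable def algProd : AlgTensor U V →ₗ[ℝ] SignedMeasure (X × Y) :=
  TensorProduct.lift (signedProd.compl₁₂ J.toLinearMap K.toLinearMap)

theorem algProd_tmul (u : U) (v : V) :
    algProd J K (AlgTensor.tmul u v) = signedProd (J u) (K v) :=
  TensorProduct.lift.tmul u v

variable {J K}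

theorem algProd_nonneg (hJ : IsSolidEmbedding J) (hK : IsSolidEmbedding K) {x : AlgTensor U V}
    (hx : x ∈ AlgTensor.cone U V) : 0 ≤ algProd J K x := by
  induction hx using AddSubmonoid.closure_induction with
  | mem x hx =>
    obtain ⟨u, v, hu, hv, rfl⟩ := hx
    rw [algProd_tmul]
    exact signedProd_nonneg ((hJ.nonneg_iff u).2 hu) ((hK.nonneg_iff v).2 hv)
  | zero => rw [map_zero]
  | add x y _ _ hx hy => rw [map_add]; exact add_nonneg hx hy

/-- Positivity carries a domination of `x` to a domination of its image, where the norm of each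
product equals its cost; then take the infimum over dominations. -/
theorem norm_algProd_le (hJ : IsSolidEmbedding J) (hK : IsSolidEmbedding K) (x : AlgTensor U V) :
    ‖algProd J K x‖ ≤ ‖x‖ := by
  refine le_csInf (AlgTensor.costs_nonempty x) ?_
  rintro _ ⟨n, u, v, hu, hv, h1, h2, rfl⟩
  have h1' := algProd_nonneg hJ hK h1
  have h2' := algProd_nonneg hJ hK h2
  rw [map_sub, map_neg, sub_nonneg] at h1'
  rw [map_sub, sub_nonneg] at h2'
  refine (RegularOrderedBanach.norm_le_of_abs_le _ _ h1' h2').trans ?_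
  rw [map_sum]
  refine (norm_sum_le _ _).trans (Finset.sum_le_sum fun i _ => ?_)
  rw [algProd_tmul, norm_signedProd_of_nonneg ((hJ.nonneg_iff _).2 (hu i))
    ((hK.nonneg_iff _).2 (hv i)), J.norm_map, K.norm_map]

/-! ### The product map is isometric -/

/-- Every tensor is approximated by sums of elementary tensors whose first factors are positive and
carried by disjoint sets. -/
theorem exists_step_tensor (hJ : IsSolidEmbedding J) (x : AlgTensor U V) {ε : ℝ} (hε : 0 < ε) :
    ∃ (ι : Type) (s : Finset ι) (A : ι → Set X) (a : ι → U) (w : ι → V),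
      (∀ c, MeasurableSet (A c)) ∧ Pairwise (Function.onFun Disjoint A) ∧ (∀ c, 0 ≤ a c) ∧
      (∀ c, J (a c) (A c)ᶜ = 0) ∧ ‖x - ∑ c ∈ s, AlgTensor.tmul (a c) (w c)‖ < ε := by
  obtain ⟨k, u, v, rfl⟩ := AlgTensor.exists_eq_sum_tmul x
  -- The added `1` keeps the divisor positive when all `v i` vanish.
  have hM : 0 < ∑ i, ‖v i‖ + 1 := by positivity
  obtain ⟨s, A, a, hA, hd, ha, ha0, hu⟩ := hJ.exists_step_approx u (div_pos hε hM)
  refine ⟨_, s, A, a, fun c => ∑ i, c i • v i, hA, hd, ha, ha0, ?_⟩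
  have e : ∑ c ∈ s, AlgTensor.tmul (a c) (∑ i, c i • v i)
      = ∑ i, AlgTensor.tmul (∑ c ∈ s, c i • a c) (v i) := by
    simp only [AlgTensor.tmul_sum, AlgTensor.sum_tmul]
    rw [Finset.sum_comm]
    exact Finset.sum_congr rfl fun i _ => Finset.sum_congr rfl fun c _ =>
      (TensorProduct.smul_tmul (R := ℝ) (c i) (a c) (v i)).symm
  have e2 : ∀ i, AlgTensor.tmul (u i) (v i) - AlgTensor.tmul (∑ c ∈ s, c i • a c) (v i)
      = AlgTensor.tmul (u i - ∑ c ∈ s, c i • a c) (v i) := fun i =>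
    (TensorProduct.sub_tmul (R := ℝ) _ _ _).symm
  rw [e, ← Finset.sum_sub_distrib]
  simp only [e2]
  calc _ ≤ ∑ i, ε / (∑ i, ‖v i‖ + 1) * ‖v i‖ :=
        (norm_sum_le _ _).trans (Finset.sum_le_sum fun i _ =>
          (AlgTensor.norm_tmul_le _ _).trans (by gcongr; exact (hu i).le))
    _ < ε := by
      rw [← Finset.mul_sum, div_mul_eq_mul_div, div_lt_iff₀ hM]
      nlinarith

/-- Since `J (a c)` is carried by `A c` and the `A c` are disjoint, only the diagonal rectangles
contribute, and `J (a c)` has mass `‖a c‖` on `A c`. -/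
theorem algProd_step_apply {ι : Type} (s : Finset ι) {A : ι → Set X}
    {a : ι → U} (w : ι → V) (hJ : IsSolidEmbedding J) (hA : ∀ c, MeasurableSet (A c))
    (hd : Pairwise (Function.onFun Disjoint A)) (ha : ∀ c, 0 ≤ a c)
    (ha0 : ∀ c, J (a c) (A c)ᶜ = 0) {P : ι → Set Y} (hP : ∀ c, MeasurableSet (P c)) :
    algProd J K (∑ c ∈ s, AlgTensor.tmul (a c) (w c)) (⋃ c ∈ s, A c ×ˢ P c)
      = ∑ c ∈ s, ‖a c‖ * K (w c) (P c) := by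
  rw [map_sum, signedMeasure_finset_sum_apply]
  refine Finset.sum_congr rfl fun c hc => ?_
  have h0 := fun c => (hJ.nonneg_iff _).2 (ha c)
  have hA1 : J (a c) (A c) = ‖a c‖ := by
    rw [← J.norm_map, norm_of_nonneg (h0 c), ← sub_eq_zero, ← neg_sub,
      ← VectorMeasure.of_compl (hA c), ha0, neg_zero]
  have hA2 : ∀ d ≠ c, J (a c) (A d) = 0 := fun d hdc =>
    le_antisymm (ha0 c ▸ signedMeasure_mono (h0 c) (hA d) (hA c).compl
      (Set.subset_compl_iff_disjoint_right.2 (hd hdc))) (h0 c _ (hA d))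
  rw [algProd_tmul, VectorMeasure.of_biUnion_finset
    (fun c _ d _ hcd => Set.disjoint_prod.2 (Or.inl (hd hcd))) fun c _ => (hA c).prod (hP c)]
  simp only [signedProd_apply_prod]
  rw [Finset.sum_eq_single c (fun d _ hdc => by rw [hA2 d hdc, zero_mul]) fun h => (h hc).elim,
    hA1]

/-- Every tensor is approximated by a difference of two tensors in the cone whose norms are read off
from the product measure on two disjoint sets. -/
theorem exists_jordan_approx (hJ : IsSolidEmbedding J) (hK : IsSolidEmbedding K)
    (x : AlgTensor U V) {ε : ℝ} (hε : 0 < ε) :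
    ∃ (t r : AlgTensor U V) (P N : Set (X × Y)), t ∈ AlgTensor.cone U V ∧
      r ∈ AlgTensor.cone U V ∧ MeasurableSet P ∧ MeasurableSet N ∧ Disjoint P N ∧
      ‖x - (t - r)‖ < ε ∧ ‖t‖ ≤ algProd J K (t - r) P ∧ ‖r‖ ≤ -algProd J K (t - r) N := by
  obtain ⟨ι, s, A, a, w, hA, hd, ha, ha0, hx⟩ := exists_step_tensor hJ x hε
  -- Only the second factors are decomposed. Disjointness of the `A c` lets their separate Hahn sets
  -- be assembled into disjoint sets in the product.
  choose p n P hp hn hw hP hpP hnP using fun c => hK.exists_jordan (w c)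
  have e : ∑ c ∈ s, AlgTensor.tmul (a c) (p c) - ∑ c ∈ s, AlgTensor.tmul (a c) (n c)
      = ∑ c ∈ s, AlgTensor.tmul (a c) (w c) := by
    rw [← Finset.sum_sub_distrib]
    refine Finset.sum_congr rfl fun c _ => ?_
    rw [hw c]
    exact (TensorProduct.tmul_sub (R := ℝ) _ _ _).symm
  refine ⟨∑ c ∈ s, AlgTensor.tmul (a c) (p c), ∑ c ∈ s, AlgTensor.tmul (a c) (n c),
    ⋃ c ∈ s, A c ×ˢ P c, ⋃ c ∈ s, A c ×ˢ (P c)ᶜ,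
    sum_mem fun c _ => AlgTensor.tmul_mem_cone (ha c) (hp c),
    sum_mem fun c _ => AlgTensor.tmul_mem_cone (ha c) (hn c),
    s.measurableSet_biUnion fun c _ => (hA c).prod (hP c),
    s.measurableSet_biUnion fun c _ => (hA c).prod (hP c).compl, ?_, by rwa [e], ?_, ?_⟩
  · simp only [Set.disjoint_iUnion_left, Set.disjoint_iUnion_right]
    intro c _ d _
    rw [Set.disjoint_prod]
    by_cases hcd : c = d
    · subst hcd; exact Or.inr disjoint_compl_right
    · exact Or.inl (hd (by tauto))
  · rw [e, algProd_step_apply s w hJ hA hd ha ha0 hP]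
    refine (AlgTensor.norm_sum_tmul_le_of_nonneg s ha hp).trans_eq ?_
    simp only [hpP]
  · rw [e, algProd_step_apply s w hJ hA hd ha ha0 fun c => (hP c).compl]
    refine (AlgTensor.norm_sum_tmul_le_of_nonneg s ha hn).trans_eq ?_
    simp only [hnP, mul_neg, Finset.sum_neg_distrib]

/-- As `P` and `N` are disjoint, `‖t - r‖ ≤ ‖t‖ + ‖r‖ ≤ ‖algProd J K (t - r)‖`. Replacing `x` by `t
- r` costs `ε / 2` on each side. -/
theorem norm_algProd (hJ : IsSolidEmbedding J) (hK : IsSolidEmbedding K) (x : AlgTensor U V) :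
    ‖algProd J K x‖ = ‖x‖ := by
  refine le_antisymm (norm_algProd_le hJ hK x) (le_of_forall_pos_le_add fun ε hε => ?_)
  obtain ⟨t, r, P, N, -, -, -, hN, hPN, hx, ht, hr⟩ := exists_jordan_approx hJ hK x (half_pos hε)
  have h1 := abs_apply_add_abs_apply_le_norm (algProd J K (t - r)) hPN hN
  have h2 := le_abs_self (algProd J K (t - r) P)
  have h3 := neg_le_abs (algProd J K (t - r) N)
  have h4 := norm_algProd_le hJ hK (x - (t - r))
  rw [map_sub] at h4
  have h5 := norm_sub_norm_le (algProd J K (t - r)) (algProd J K x)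
  have h6 := norm_sub_norm_le x (t - r)
  have h7 := norm_sub_le t r
  rw [norm_sub_rev] at h5
  linarith

/-! ### Extension to the completion and reflection of order -/

/-- The canonical map into the completion, as a linear map. -/
noncomputable def Tensor.mkₗ : AlgTensor U V →ₗ[ℝ] Tensor U V where
  toFun := Tensor.mk
  map_add' := Tensor.mk_add
  map_smul' := Tensor.mk_smul

/-- The bound under which `extendOfNorm` agrees with `algProd` on the dense image. -/
theorem exists_norm_algProd_le (hJ : IsSolidEmbedding J) (hK : IsSolidEmbedding K) :
    ∃ C : ℝ, ∀ x : AlgTensor U V, ‖algProd J K x‖ ≤ C * ‖Tensor.mkₗ x‖ :=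
  ⟨1, fun x => by
    rw [one_mul, show ‖(Tensor.mkₗ x : Tensor U V)‖ = ‖x‖ from Tensor.norm_mk x]
    exact norm_algProd_le hJ hK x⟩

variable (J K) in
/-- The extension of `algProd` to the positive projective tensor product. -/
noncomputable def tensorProd : Tensor U V →L[ℝ] SignedMeasure (X × Y) :=
  (algProd J K).extendOfNorm Tensor.mkₗ

theorem tensorProd_mk (hJ : IsSolidEmbedding J) (hK : IsSolidEmbedding K) (x : AlgTensor U V) :
    tensorProd J K (Tensor.mk x) = algProd J K x :=
  LinearMap.extendOfNorm_eq Tensor.denseRange_mk (exists_norm_algProd_le hJ hK) x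

theorem norm_tensorProd (hJ : IsSolidEmbedding J) (hK : IsSolidEmbedding K) (z : Tensor U V) :
    ‖tensorProd J K z‖ = ‖z‖ := by
  refine Tensor.denseRange_mk.induction_on z ?_ fun x => ?_
  · exact isClosed_eq (by fun_prop) (by fun_prop)
  · rw [tensorProd_mk hJ hK, norm_algProd hJ hK, Tensor.norm_mk]

theorem tensorProd_nonneg (hJ : IsSolidEmbedding J) (hK : IsSolidEmbedding K) {z : Tensor U V}
    (hz : 0 ≤ z) : 0 ≤ tensorProd J K z := by
  rw [Tensor.le_def, sub_zero] at hz
  obtain ⟨p, hp, hpz⟩ := Tensor.exists_seq_of_mem_cone hz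
  refine RegularOrderedBanach.isClosed_cone.mem_of_tendsto
    (((tensorProd J K).continuous.tendsto z).comp hpz) (Eventually.of_forall fun n => ?_)
  simp only [Function.comp_apply, tensorProd_mk hJ hK]
  exact algProd_nonneg hJ hK (hp n)

/-- Approximate `z` by `t - r`. The image of `z` is nonnegative on `N`, while that of `t - r` is at
most `-‖r‖` there; so `‖r‖` is bounded by the approximation error, and `z` is close to the cone
element `t`. -/
theorem nonneg_of_tensorProd_nonneg (hJ : IsSolidEmbedding J) (hK : IsSolidEmbedding K)
    {z : Tensor U V} (hz : 0 ≤ tensorProd J K z) : 0 ≤ z := by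
  rw [Tensor.le_def, sub_zero]
  refine Metric.mem_closure_iff.2 fun ε hε => ?_
  -- Two errors of `ε / 4` put `z` within `ε / 2` of `t - r`; the remaining `ε / 2` absorbs `r`.
  obtain ⟨x, hx⟩ := Metric.denseRange_iff.1 Tensor.denseRange_mk z (ε / 4) (by positivity)
  obtain ⟨t, r, P, N, ht, -, -, hN, -, hxt, -, hr⟩ :=
    exists_jordan_approx hJ hK x (ε := ε / 4) (by positivity)
  refine ⟨Tensor.mk t, ⟨t, ht, rfl⟩, ?_⟩
  rw [dist_eq_norm] at hx ⊢
  rw [← Tensor.norm_mk, Tensor.mk_sub] at hxt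
  have h1 : ‖z - Tensor.mk (t - r)‖ < ε / 2 := by
    have := norm_sub_le_norm_sub_add_norm_sub z (Tensor.mk x) (Tensor.mk (t - r))
    linarith
  have h2 : ‖r‖ < ε / 2 := by
    have h3 := abs_apply_le_norm (tensorProd J K (z - Tensor.mk (t - r))) N
    rw [norm_tensorProd hJ hK, map_sub, tensorProd_mk hJ hK, sub_apply] at h3
    have h4 := le_abs_self (tensorProd J K z N - algProd J K (t - r) N)
    have h5 : 0 ≤ tensorProd J K z N := hz N hN
    linarith
  have h6 : z - Tensor.mk t = (z - Tensor.mk (t - r)) - Tensor.mk r := by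
    rw [Tensor.mk_sub]; abel
  rw [h6]
  have h7 := norm_sub_le (z - Tensor.mk (t - r)) (Tensor.mk r)
  rw [Tensor.norm_mk] at h7
  linarith

variable (J K) in
/-- The isometric embedding of the positive projective tensor product into the measures on the
product space. -/
noncomputable def tensorIsometry (hJ : IsSolidEmbedding J) (hK : IsSolidEmbedding K) :
    Tensor U V →ₗᵢ[ℝ] SignedMeasure (X × Y) where
  toLinearMap := (tensorProd J K).toLinearMap
  norm_map' := norm_tensorProd hJ hK

/-! ### The range is an order ideal -/

/-- A closed subspace of measures contains all restrictions of a finite measure if it contains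
those to the members of a generating `π`-system. -/
theorem restrict_mem_of_isPiSystem {Z : Type} [hZ : MeasurableSpace Z]
    {R : Submodule ℝ (SignedMeasure Z)}
    (hR : IsClosed (R : Set (SignedMeasure Z))) (m : Measure Z) [IsFiniteMeasure m]
    {C : Set (Set Z)} (hgen : hZ = MeasurableSpace.generateFrom C) (hC : IsPiSystem C)
    (huniv : m.toSignedMeasure ∈ R) (h : ∀ A ∈ C, (m.restrict A).toSignedMeasure ∈ R)
    (A : Set Z) (hA : MeasurableSet A) : (m.restrict A).toSignedMeasure ∈ R := by
  induction A, hA using MeasurableSpace.induction_on_inter hgen hC with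
  | empty =>
    have : (m.restrict ∅).toSignedMeasure = 0 := by ext E hE; simp
    rw [this]
    exact zero_mem R
  | basic A hA => exact h A hA
  | compl A hA ih =>
    have : (m.restrict Aᶜ).toSignedMeasure
        = m.toSignedMeasure - (m.restrict A).toSignedMeasure := by
      ext E hE
      rw [sub_apply, Measure.toSignedMeasure_apply_measurable hE,
        Measure.toSignedMeasure_apply_measurable hE, Measure.toSignedMeasure_apply_measurable hE,
        measureReal_restrict_apply hE, measureReal_restrict_apply hE, eq_sub_iff_add_eq,
        ← Set.sdiff_eq, add_comm]
      exact measureReal_inter_add_sdiff hA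
    rw [this]
    exact sub_mem huniv ih
  | iUnion f hd hf ih =>
    have hsum : ∀ E, MeasurableSet E →
        HasSum (fun i => m.real (E ∩ f i)) (m.real (E ∩ ⋃ i, f i)) := fun E hE => by
      rw [Set.inter_iUnion]
      have := m.toSignedMeasure.hasSum_of_disjoint_iUnion (fun i => hE.inter (hf i))
        fun i j hij => (hd hij).mono Set.inter_subset_right Set.inter_subset_right
      simpa [hE.inter (hf _), MeasurableSet.iUnion fun i => hE.inter (hf i)] using this
    -- Each restriction has norm equal to its mass, and the masses of disjoint pieces are summable,
    -- so the series converges absolutely in total variation.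
    have hs : Summable fun i => (m.restrict (f i)).toSignedMeasure := by
      refine Summable.of_norm ?_
      simpa [variation_toSignedMeasure] using (hsum _ MeasurableSet.univ).summable
    have : ∑' i, (m.restrict (f i)).toSignedMeasure = (m.restrict (⋃ i, f i)).toSignedMeasure := by
      ext E hE
      have h1 := (evalCLM E).hasSum hs.hasSum
      have h2 := hsum E hE
      simp only [evalCLM_apply, Measure.toSignedMeasure_apply_measurable hE,
        measureReal_restrict_apply hE] at h1 ⊢
      exact h1.unique h2
    rw [← this]
    exact hR.mem_of_tendsto hs.hasSum (Eventually.of_forall fun s => sum_mem fun i _ => ih i)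

/-- A closed subspace of measures containing all restrictions of a finite measure contains
everything with a density with respect to that measure. -/
theorem withDensityᵥ_mem_of_restrict_mem {Z : Type} [MeasurableSpace Z]
    {R : Submodule ℝ (SignedMeasure Z)}
    (hR : IsClosed (R : Set (SignedMeasure Z))) (m : Measure Z) [IsFiniteMeasure m]
    (h : ∀ A, MeasurableSet A → (m.restrict A).toSignedMeasure ∈ R) {f : Z → ℝ}
    (hf : Integrable f m) : m.withDensityᵥ f ∈ R := by
  refine Integrable.induction (fun f => m.withDensityᵥ f ∈ R) (fun c A hA _ => ?_)
    (fun f g _ hf hg hfR hgR => ?_) ?_ (fun f g hfg _ hfR => ?_) hf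
  · rw [withDensityᵥ_indicator m c hA]
    exact R.smul_mem c (h A hA)
  · rw [withDensityᵥ_add hf hg]
    exact add_mem hfR hgR
  · have hcont : Continuous fun f : Lp ℝ 1 m => m.withDensityᵥ f := by
      refine continuous_iff_continuousAt.2 fun f => tendsto_iff_norm_sub_tendsto_zero.2 ?_
      refine squeeze_zero (fun _ => norm_nonneg _) (fun g => ?_)
        (tendsto_iff_norm_sub_tendsto_zero.1 (tendsto_id (x := 𝓝 f)))
      have hf := L1.integrable_coeFn f
      have hg := L1.integrable_coeFn g
      rw [← withDensityᵥ_sub hg hf, id, L1.norm_eq_integral_norm]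
      refine (norm_withDensityᵥ_le (hg.sub hf)).trans_eq (integral_congr_ae ?_)
      filter_upwards [Lp.coeFn_sub g f] with x hx
      rw [hx, Real.norm_eq_abs]
    exact hR.preimage hcont
  · rwa [← WithDensityᵥEq.congr_ae hfg]

/-- The completed tensor product is complete and the map isometric; this is what allows membership
in the range to be proved by approximation. -/
theorem isClosed_range_tensorIsometry (hJ : IsSolidEmbedding J) (hK : IsSolidEmbedding K) :
    IsClosed (LinearMap.range (tensorIsometry J K hJ hK).toLinearMap :
      Set (SignedMeasure (X × Y))) :=
  (tensorIsometry J K hJ hK).isometry.isClosedEmbedding.isClosed_range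

/-- The measure `ρ` has a density with respect to the product `m × n` of `J a` and `K b`. The
restriction of `m × n` to a rectangle is the product of restrictions, whose factors lift by solidity
of `J` and `K`. Rectangles form a generating π-system, so all restrictions, and then `ρ`, lie in the
closed range. -/
theorem mem_range_of_le_signedProd (hJ : IsSolidEmbedding J) (hK : IsSolidEmbedding K) {a : U}
    {b : V} (ha : 0 ≤ a) (hb : 0 ≤ b) {ρ : SignedMeasure (X × Y)} (h0 : 0 ≤ ρ)
    (hρ : ρ ≤ signedProd (J a) (K b)) :
    ρ ∈ LinearMap.range (tensorIsometry J K hJ hK).toLinearMap := by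
  have hR := isClosed_range_tensorIsometry hJ hK
  set R := LinearMap.range (tensorIsometry J K hJ hK).toLinearMap
  have hmem : ∀ u v, signedProd (J u) (K v) ∈ R := fun u v =>
    ⟨Tensor.mk (AlgTensor.tmul u v), (tensorProd_mk hJ hK _).trans (algProd_tmul J K u v)⟩
  set m := (J a).variation
  set n := (K b).variation
  have hma : m.toSignedMeasure = J a :=
    toSignedMeasure_variation_of_nonneg ((hJ.nonneg_iff a).2 ha)
  have hnb : n.toSignedMeasure = K b :=
    toSignedMeasure_variation_of_nonneg ((hK.nonneg_iff b).2 hb)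
  have hmn : (m.prod n).toSignedMeasure = signedProd (J a) (K b) := by
    rw [← signedProd_toSignedMeasure, hma, hnb]
  obtain ⟨f, hf, rfl⟩ := exists_density (m := m.prod n) (μ := ρ) fun A hA => by
    rw [← Measure.toSignedMeasure_apply_measurable hA, hmn, abs_of_nonneg (h0 A hA)]
    exact hρ A hA
  refine withDensityᵥ_mem_of_restrict_mem hR _ (restrict_mem_of_isPiSystem hR (m.prod n)
    generateFrom_prod.symm isPiSystem_prod (hmn ▸ hmem a b) ?_) hf
  rintro _ ⟨A, -, B, -, rfl⟩
  obtain ⟨u, hu⟩ := hJ.solid a (m.restrict A).toSignedMeasure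
    (Measure.zero_le_toSignedMeasure _) (le_of_le_of_eq
      ((Measure.toSignedMeasure_le_toSignedMeasure_iff _ m).2 Measure.restrict_le_self) hma)
  obtain ⟨v, hv⟩ := hK.solid b (n.restrict B).toSignedMeasure
    (Measure.zero_le_toSignedMeasure _) (le_of_le_of_eq
      ((Measure.toSignedMeasure_le_toSignedMeasure_iff _ n).2 Measure.restrict_le_self) hnb)
  have h := hmem u v
  rw [hu, hv, signedProd_toSignedMeasure] at h
  rwa [← Measure.toSignedMeasure_congr (Measure.prod_restrict A B)]

/-- A sum of positive tensors lies below the single tensor of the summed factors, because the cross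
terms are positive. -/
theorem exists_algProd_le_signedProd (hJ : IsSolidEmbedding J) (hK : IsSolidEmbedding K)
    {x : AlgTensor U V} (hx : x ∈ AlgTensor.cone U V) :
    ∃ (a : U) (b : V), 0 ≤ a ∧ 0 ≤ b ∧ algProd J K x ≤ signedProd (J a) (K b) := by
  induction hx using AddSubmonoid.closure_induction with
  | mem x hx =>
    obtain ⟨u, v, hu, hv, rfl⟩ := hx
    exact ⟨u, v, hu, hv, (algProd_tmul J K u v).le⟩
  | zero => exact ⟨0, 0, le_rfl, le_rfl, by simp⟩
  | add x y _ _ hx hy =>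
    obtain ⟨a, b, ha, hb, h⟩ := hx
    obtain ⟨c, d, hc, hd, h'⟩ := hy
    refine ⟨a + c, b + d, add_nonneg ha hc, add_nonneg hb hd, ?_⟩
    have h1 : 0 ≤ signedProd (J a) (K d) :=
      signedProd_nonneg ((hJ.nonneg_iff a).2 ha) ((hK.nonneg_iff d).2 hd)
    have h2 : 0 ≤ signedProd (J c) (K b) :=
      signedProd_nonneg ((hJ.nonneg_iff c).2 hc) ((hK.nonneg_iff b).2 hb)
    simp only [map_add, LinearMap.add_apply]
    refine (add_le_add h h').trans ?_
    rw [← sub_nonneg]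
    convert add_nonneg h1 h2 using 1
    abel

theorem tensorProd_le_iff (hJ : IsSolidEmbedding J) (hK : IsSolidEmbedding K) (x y : Tensor U V) :
    tensorProd J K x ≤ tensorProd J K y ↔ x ≤ y := by
  rw [← sub_nonneg, ← map_sub, ← sub_nonneg (a := y)]
  exact ⟨nonneg_of_tensorProd_nonneg hJ hK, tensorProd_nonneg hJ hK⟩

/-- The element `z` is a limit of elements `p n` of the algebraic cone. Truncating `ρ` by their
images gives measures `κ n` that lie below products, hence in the range, and that converge to `ρ`;
the range is closed. -/
theorem mem_range_of_le_tensorProd (hJ : IsSolidEmbedding J) (hK : IsSolidEmbedding K)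
    (z : Tensor U V) (ρ : SignedMeasure (X × Y)) (h0 : 0 ≤ ρ) (hρ : ρ ≤ tensorProd J K z) :
    ρ ∈ LinearMap.range (tensorIsometry J K hJ hK).toLinearMap := by
  have hz : 0 ≤ z := nonneg_of_tensorProd_nonneg hJ hK (h0.trans hρ)
  rw [Tensor.le_def, sub_zero] at hz
  obtain ⟨p, hp, hpz⟩ := Tensor.exists_seq_of_mem_cone hz
  choose κ hκ0 hκ hκρ using fun n => exists_nonneg_le_of_le isRiesz_signedMeasure h0 hρ
    (algProd_nonneg hJ hK (hp n))
  refine (isClosed_range_tensorIsometry hJ hK).mem_of_tendsto (f := κ) (b := atTop) ?_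
    (Eventually.of_forall fun n => ?_)
  · rw [tendsto_iff_norm_sub_tendsto_zero] at hpz ⊢
    refine squeeze_zero (fun _ => norm_nonneg _) (fun n => ?_) hpz
    rw [norm_sub_rev, norm_sub_rev _ z, ← norm_tensorProd hJ hK, map_sub, tensorProd_mk hJ hK]
    exact hκρ n
  · obtain ⟨a, b, ha, hb, h⟩ := exists_algProd_le_signedProd hJ hK (hp n)
    exact mem_range_of_le_signedProd hJ hK ha hb (hκ0 n) ((hκ n).trans h)

theorem isSolidEmbedding_tensorIsometry (hJ : IsSolidEmbedding J) (hK : IsSolidEmbedding K) :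
    IsSolidEmbedding (V := U.tensor V) (tensorIsometry J K hJ hK) where
  le_iff := tensorProd_le_iff hJ hK
  solid := mem_range_of_le_tensorProd hJ hK

end

/-! ### Induction on measure types -/

theorem MeasureType.exists_isSolidEmbedding {V : RoBan} (T : MeasureType V) :
    ∃ (X : Type) (_ : MeasurableSpace X) (J : V →ₗᵢ[ℝ] SignedMeasure X), IsSolidEmbedding J := by
  induction T with
  | fin | int | real => exact ⟨_, _, _, IsSolidEmbedding.id⟩
  -- These constructors carry `borel _` explicitly, so the σ-algebra has to be supplied by hand.
  | posDef | measures => exact ⟨_, borel _, _, @IsSolidEmbedding.id _ (borel _)⟩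
  | bayes T μ ih =>
    obtain ⟨X, _, J, hJ⟩ := ih
    exact ⟨X, _, hJ.exists_band μ⟩
  | tensor S T ihS ihT =>
    obtain ⟨X, _, J, hJ⟩ := ihS
    obtain ⟨Y, _, K, hK⟩ := ihT
    exact ⟨X × Y, _, _, isSolidEmbedding_tensorIsometry hJ hK⟩

end MeasSem

theorem mainTheorem6 {V : MeasSem.RoBan} (T : MeasSem.MeasureType V) :
    MeasSem.IsRiesz T.den ∧
      ∃ (X : Type) (_ : MeasurableSpace X) (J : T.den →ₗᵢ[ℝ] MeasSem.RoBan.measures X),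
        ∀ x y : T.den, J x ≤ J y ↔ x ≤ y := by
  obtain ⟨X, hX, J, hJ⟩ := T.exists_isSolidEmbedding
  exact ⟨hJ.isRiesz, X, hX, J, hJ.le_iff⟩
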